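/- Let $\lambda,\mu,r>0$ and $\zeta^{+},\zeta^{-}\in\mathbb R$, let $(e_n)_{n\ge 0}$ be the canonical orthonormal basis of $\mathsf h=\ell^2(\mathbb N)$, and put $\omega_n=n(n+r-1)$. Let $B,B^+$ be the operators with domain $\{u:\sum_n n^2|u_n|^2<\infty\}$ given by $Be_n=\omega_n^{1/2}e_{n-1}$ for $n\ge 1$, $Be_0=0$, and $B^+e_n=\omega_{n+1}^{1/2}e_{n+1}$; let $L_1=\mu B$, $L_2=\lambda B^+$, $G=-\frac{\lambda^2}{2}BB^+-\frac{\mu^2}{2}B^+B-\mathrm i(\zeta^+BB^++\zeta^-B^+B)$, and $P_t=\mathrm e^{tG}$. Let $\mathcal T=(\mathcal T_t)_{t\ge 0}$ be the minimal quantum dynamical semigroup on $\mathcal B(\mathsf h)$ associated with $G,L_1,L_2$, that is, $\mathcal T_t(x)$ is the weak limit of the Picard iterates, started from $P_t^*xP_t$, of the equation $$\langle v,\mathcal T_t(x)u\rangle=\langle P_tv,xP_tu\rangle+\sum_{\ell=1}^{2}\int_0^t\langle L_\ell P_{t-s}v,\mathcal T_s(x)L_\ell P_{t-s}u\rangle\,ds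 .$$ (For $\lambda\le\mu$ it is a quantum Markov semigroup.) If $\lambda=\mu$, then: 1. $\mathcal T$ is transient: there is a bounded operator $x\ge 0$ with $\langle u,xu\rangle>0$ for all $u\ne 0$ whose potential is bounded, i.e. for some constant $C$, $\int_0^\infty\langle u,\mathcal T_t(x)u\rangle\,dt\le C\|u\|^2$ for all $u\in\mathsf h$. 2. In particular, $\mathcal T$ has no invariant normal state: there is no positive trace class operator $\rho$ with $\operatorname{tr}\rho=1$ and $\operatorname{tr}(\rho\,\mathcal T_t(x))=\operatorname{tr}(\rho x)$ for all $t\ge 0$ and $x\in\mathcal B(\mathsf h)$. 3. Moreover, the operator $X$ given by $Xe_n=\Big(\sum_{k\ge n}\frac{1}{(k+1)(k+r)}\Big)e_n$ is bounded, satisfies $X\ge 0$ and $\langle u,Xu\rangle>0$ for all $u\ne 0$, and is superharmonic: $\mathcal T_t(X)\le X$ for all $t\ge 0$. -/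

import Mathlib

noncomputable section

open MeasureTheory Filter Topology
open scoped NNReal ENNReal

namespace QuadOsc

/-- The Hilbert space `ℓ²(ℕ)`. -/
abbrev Fock : Type := lp (fun _ : ℕ => ℂ) 2

/-- The canonical orthonormal basis of `ℓ²(ℕ)`. -/
def e (n : ℕ) : Fock := lp.single 2 n (1 : ℂ)

/-- The real parameters `λ, μ > 0`, `r > 0` and `ζ⁺, ζ⁻` of the model. -/
structure Params where
  lam : ℝ
  mu : ℝ
  r : ℝ
  zetaPlus : ℝ
  zetaMinus : ℝ
  lam_pos : 0 < lam
  mu_pos : 0 < mu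
  r_pos : 0 < r

namespace Params

variable (p : Params)

/-- `ωₙ = n (n + r - 1)`. -/
def omega (n : ℕ) : ℝ := n * (n + p.r - 1)

theorem omega_nonneg (n : ℕ) : 0 ≤ p.omega n := by
  rcases n with _ | n
  · simp [omega]
  · have := p.r_pos
    simp only [omega, Nat.cast_add, Nat.cast_one]
    have h : ((n : ℝ) + 1) * (n + 1 + p.r - 1) = (n + 1) * (n + p.r) := by ring
    rw [h]; positivity

theorem omega_le (n : ℕ) : p.omega n ≤ (1 + p.r) * (n : ℝ) ^ 2 := by
  rcases n with _ | n
  · simp [omega]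
  · have := p.r_pos
    simp only [omega, Nat.cast_add, Nat.cast_one]
    have hn : (0 : ℝ) ≤ n := n.cast_nonneg
    nlinarith [mul_nonneg this.le hn, mul_nonneg (mul_nonneg this.le hn) hn]

end Params

theorem hasSum_norm_sq (u : Fock) : HasSum (fun n => ‖u n‖ ^ 2) (‖u‖ ^ 2) := by
  have h := lp.hasSum_norm (p := 2) (by simp) u
  simpa using h

theorem memlp_iff (f : ℕ → ℂ) : Memℓp f 2 ↔ Summable fun n => ‖f n‖ ^ 2 := by
  rw [memℓp_gen_iff (by simp)]
  simp

/-- The domain of the number operator `N`, `N eₙ = n eₙ`. -/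
def domN : Submodule ℂ Fock where
  carrier := {u | Summable fun n : ℕ => (n : ℝ) ^ 2 * ‖u n‖ ^ 2}
  zero_mem' := by simp
  add_mem' := by
    intro u v hu hv
    refine Summable.of_nonneg_of_le (fun n => by positivity) (fun n => ?_)
      ((hu.add hv).mul_left 2)
    have h1 : ‖(u + v) n‖ ≤ ‖u n‖ + ‖v n‖ := norm_add_le _ _
    have h2 : ‖(u + v) n‖ ^ 2 ≤ 2 * (‖u n‖ ^ 2 + ‖v n‖ ^ 2) := by
      nlinarith [sq_nonneg (‖u n‖ - ‖v n‖), norm_nonneg ((u + v) n)]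
    nlinarith [mul_le_mul_of_nonneg_left h2 (sq_nonneg (n : ℝ))]
  smul_mem' := by
    intro c u hu
    refine (Summable.mul_left (‖c‖ ^ 2) hu).congr (fun n => ?_)
    have : (c • u) n = c * u n := rfl
    rw [this, norm_mul]; ring

theorem e_apply (n m : ℕ) : e n m = if m = n then 1 else 0 := by
  simp [e, Pi.single_apply]

theorem e_mem (n : ℕ) : e n ∈ domN := by
  refine summable_of_ne_finset_zero (s := {n}) (fun m hm => ?_)
  simp only [Finset.mem_singleton] at hm
  simp [e_apply, hm]

theorem hasSum_e (u : Fock) : HasSum (fun n => u n • e n) u := by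
  have h := lp.hasSum_single (p := 2) (by simp) u
  refine h.congr_fun ?_
  intro n
  simp only [e, ← lp.single_smul, smul_eq_mul, mul_one]

theorem dense_domN : Dense (domN : Set Fock) := by
  intro u
  refine mem_closure_of_tendsto (hasSum_e u) (Eventually.of_forall fun s => ?_)
  exact Submodule.sum_mem _ fun n _ => Submodule.smul_mem _ _ (e_mem n)

namespace Params

variable (p : Params)

/-- The annihilation operator `B`, with domain `domN`: `B eₙ = √ωₙ eₙ₋₁`, `B e₀ = 0`. -/
def B : domN →ₗ[ℂ] Fock where
  toFun u := ⟨fun n => (√(p.omega (n + 1)) : ℂ) * (u : Fock) (n + 1), by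
    refine (memlp_iff _).2 ?_
    have h := (summable_nat_add_iff 1).2 u.2
    refine Summable.of_nonneg_of_le (fun n => by positivity) (fun n => ?_)
      (h.mul_left (1 + p.r))
    rw [norm_mul, mul_pow, Complex.norm_real, Real.norm_eq_abs, sq_abs,
      Real.sq_sqrt (p.omega_nonneg _), ← mul_assoc]
    exact mul_le_mul_of_nonneg_right (p.omega_le _) (sq_nonneg _)⟩
  map_add' u v := by
    ext n; exact mul_add _ _ _
  map_smul' c u := by
    ext n; exact mul_left_comm _ _ _

/-- The creation operator `B⁺`, with domain `domN`: `B⁺ eₙ = √ωₙ₊₁ eₙ₊₁`. In coordinates,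
`(B⁺ u)ₙ = √ωₙ uₙ₋₁`, which vanishes at `n = 0` because `ω₀ = 0`. -/
def Bdag : domN →ₗ[ℂ] Fock where
  toFun u := ⟨fun n => (√(p.omega n) : ℂ) * (u : Fock) (n - 1), by
    refine (memlp_iff _).2 ((summable_nat_add_iff 1).1 ?_)
    have h := (u.2.add (hasSum_norm_sq (u : Fock)).summable).mul_left (2 * (1 + p.r))
    refine Summable.of_nonneg_of_le (fun n => by positivity) (fun n => ?_) h
    rw [norm_mul, mul_pow, Complex.norm_real, Real.norm_eq_abs, sq_abs,
      Real.sq_sqrt (p.omega_nonneg _), Nat.add_sub_cancel]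
    have h1 := p.omega_le (n + 1)
    have h2 : p.omega (n + 1) ≤ 2 * (1 + p.r) * ((n : ℝ) ^ 2 + 1) := by
      push_cast at h1
      have := p.r_pos
      nlinarith [mul_nonneg (by linarith : (0 : ℝ) ≤ 1 + p.r) (sq_nonneg ((n : ℝ) - 1))]
    calc p.omega (n + 1) * ‖(u : Fock) n‖ ^ 2
        ≤ (2 * (1 + p.r) * ((n : ℝ) ^ 2 + 1)) * ‖(u : Fock) n‖ ^ 2 :=
          mul_le_mul_of_nonneg_right h2 (sq_nonneg _)
      _ = _ := by ring⟩
  map_add' u v := by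
    ext n; exact mul_add _ _ _
  map_smul' c u := by
    ext n; exact mul_left_comm _ _ _

/-- The Kraus operators `L₁ = μ B` and `L₂ = λ B⁺`. -/
def L : Fin 2 → (domN →ₗ[ℂ] Fock) := ![(p.mu : ℂ) • p.B, (p.lam : ℂ) • p.Bdag]

/-- Minus the eigenvalues of
`G = -(λ²/2) B B⁺ - (μ²/2) B⁺ B - i (ζ⁺ B B⁺ + ζ⁻ B⁺ B)`, that is `G eₙ = - p.g n • eₙ`. -/
def g (n : ℕ) : ℂ :=
  ((p.lam : ℂ) ^ 2 / 2 + Complex.I * p.zetaPlus) * p.omega (n + 1) +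
    ((p.mu : ℂ) ^ 2 / 2 + Complex.I * p.zetaMinus) * p.omega n

theorem g_re (n : ℕ) :
    (p.g n).re = p.lam ^ 2 / 2 * p.omega (n + 1) + p.mu ^ 2 / 2 * p.omega n := by
  simp [g, ← Complex.ofReal_pow]

theorem g_re_nonneg (n : ℕ) : 0 ≤ (p.g n).re := by
  rw [g_re]
  have := p.omega_nonneg n
  have := p.omega_nonneg (n + 1)
  positivity

theorem norm_exp (t : ℝ≥0) (n : ℕ) :
    ‖Complex.exp (-(t : ℂ) * p.g n)‖ = Real.exp (-(t : ℝ) * (p.g n).re) := by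
  rw [Complex.norm_exp]; simp

theorem norm_exp_le (t : ℝ≥0) (n : ℕ) : ‖Complex.exp (-(t : ℂ) * p.g n)‖ ≤ 1 := by
  rw [norm_exp, Real.exp_le_one_iff]
  have := mul_nonneg t.2 (p.g_re_nonneg n)
  simpa using this

/-- The contraction semigroup generated by `G`: `P_t eₙ = exp (-t g n) eₙ`. -/
def P (t : ℝ≥0) : Fock →L[ℂ] Fock :=
  LinearMap.mkContinuous
    { toFun := fun u => ⟨fun n => Complex.exp (-(t : ℂ) * p.g n) * u n, by
        refine (memlp_iff _).2 ?_
        refine Summable.of_nonneg_of_le (fun n => by positivity) (fun n => ?_)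
          (hasSum_norm_sq u).summable
        rw [norm_mul]
        gcongr
        exact mul_le_of_le_one_left (norm_nonneg _) (p.norm_exp_le t n)⟩
      map_add' := fun u v => by ext n; exact mul_add _ _ _
      map_smul' := fun c u => by ext n; exact mul_left_comm _ _ _ } 1
    (fun u => by
      rw [one_mul]
      refine le_of_sq_le_sq ?_ (norm_nonneg _)
      refine hasSum_le (fun n => ?_) (hasSum_norm_sq _) (hasSum_norm_sq u)
      change ‖Complex.exp (-(t : ℂ) * p.g n) * u n‖ ^ 2 ≤ _
      rw [norm_mul]
      gcongr
      exact mul_le_of_le_one_left (norm_nonneg _) (p.norm_exp_le t n))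

theorem P_apply (t : ℝ≥0) (u : Fock) (n : ℕ) :
    p.P t u n = Complex.exp (-(t : ℂ) * p.g n) * u n := rfl

theorem norm_P_apply_le (t : ℝ≥0) (u : Fock) (n : ℕ) : ‖p.P t u n‖ ≤ ‖u n‖ := by
  rw [P_apply, norm_mul]
  exact mul_le_of_le_one_left (norm_nonneg _) (p.norm_exp_le t n)

theorem P_mem (t : ℝ≥0) {u : Fock} (hu : u ∈ domN) : p.P t u ∈ domN := by
  refine Summable.of_nonneg_of_le (fun n => by positivity) (fun n => ?_) hu
  have := p.norm_P_apply_le t u n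
  gcongr

/-- `P_t` restricted to the invariant domain `domN`. -/
def Pdom (t : ℝ≥0) (u : domN) : domN := ⟨p.P t u, p.P_mem t u.2⟩

/-- The right-hand side of the Lindblad equation
`⟨v, P_t* x P_t u⟩ + ∑_ℓ ∫₀ᵗ ⟨L_ℓ P_{t-s} v, S_s L_ℓ P_{t-s} u⟩ ds`. -/
def lindbladForm (x : Fock →L[ℂ] Fock) (S : ℝ≥0 → (Fock →L[ℂ] Fock)) (t : ℝ≥0)
    (v u : domN) : ℂ :=
  inner ℂ (p.P t v) (x (p.P t u)) +
    ∑ l : Fin 2, ∫ s in (0 : ℝ)..t,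
      inner ℂ (p.L l (p.Pdom (t - s.toNNReal) v))
        (S s.toNNReal (p.L l (p.Pdom (t - s.toNNReal) u)))

/-- The Picard iterates of the Lindblad equation with initial datum `x`, started from
`P_t* x P_t`. -/
structure IsPicard (x : Fock →L[ℂ] Fock) (S : ℕ → ℝ≥0 → (Fock →L[ℂ] Fock)) : Prop where
  zero : ∀ t, S 0 t = (p.P t).adjoint ∘L x ∘L p.P t
  succ : ∀ n t (v u : domN),
    inner ℂ (v : Fock) (S (n + 1) t (u : Fock)) = p.lindbladForm x (S n) t v u

end Params

theorem exists_op {W : Submodule ℂ Fock} (hW : Dense (W : Set Fock)) (q : W → W → ℂ) {C : ℝ}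
    (hC : 0 ≤ C) (add_left : ∀ v w u, q (v + w) u = q v u + q w u)
    (smul_left : ∀ (c : ℂ) v u, q (c • v) u = starRingEnd ℂ c * q v u)
    (add_right : ∀ v u w, q v (u + w) = q v u + q v w)
    (smul_right : ∀ (c : ℂ) v u, q v (c • u) = c * q v u)
    (bd : ∀ v u, ‖q v u‖ ≤ C * ‖v‖ * ‖u‖) :
    ∃ A : Fock →L[ℂ] Fock, (∀ v u : W, inner ℂ (v : Fock) (A u) = q v u) ∧ ‖A‖ ≤ C := by
  have hd : DenseRange W.subtype := by simpa [DenseRange] using hW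
  let f : W → (W →ₗ[ℂ] ℂ) := fun u =>
    { toFun := fun v => starRingEnd ℂ (q v u)
      map_add' := fun v w => by rw [add_left, map_add]
      map_smul' := fun c v => by rw [smul_left, map_mul]; simp }
  have hf : ∀ u v, ‖f u v‖ ≤ (C * ‖u‖) * ‖W.subtype v‖ := fun u v => by
    have := bd v u
    simp only [f, LinearMap.coe_mk, AddHom.coe_mk, RCLike.norm_conj, Submodule.subtype_apply,
      Submodule.coe_norm] at this ⊢
    linarith
  let w : W → Fock := fun u =>
    (InnerProductSpace.toDual ℂ Fock).symm ((f u).extendOfNorm W.subtype)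
  have hw : ∀ u v : W, inner ℂ (w u) (v : Fock) = starRingEnd ℂ (q v u) := fun u v => by
    simp only [w, InnerProductSpace.toDual_symm_apply]
    exact LinearMap.extendOfNorm_eq hd ⟨_, hf u⟩ v
  have hwn : ∀ u, ‖w u‖ ≤ C * ‖W.subtype u‖ := fun u => by
    simp only [w, LinearIsometryEquiv.norm_map]
    exact ContinuousLinearMap.opNorm_le_bound _ (by positivity)
      (LinearMap.norm_extendOfNorm_apply_le hd _ (hf u))
  let wl : W →ₗ[ℂ] Fock :=
    { toFun := w
      map_add' := fun u u' => hW.eq_of_inner_left ℂ fun v hv => by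
        have h := fun z => hw z ⟨v, hv⟩
        simp only at h
        rw [inner_add_left, h, h, h, add_right, map_add]
      map_smul' := fun c u => hW.eq_of_inner_left ℂ fun v hv => by
        have h := fun z => hw z ⟨v, hv⟩
        simp only at h
        rw [RingHom.id_apply, inner_smul_left, h, h, smul_right, map_mul] }
  refine ⟨wl.extendOfNorm W.subtype, fun v u => ?_, ?_⟩
  · have h1 : wl.extendOfNorm W.subtype u = w u := LinearMap.extendOfNorm_eq hd ⟨C, hwn⟩ u
    rw [h1, ← inner_conj_symm, hw, Complex.conj_conj]
  · exact ContinuousLinearMap.opNorm_le_bound _ hC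
      (LinearMap.norm_extendOfNorm_apply_le hd C hwn)

theorem form_bound {W : Submodule ℂ Fock} (q : W → W → ℂ) {C : ℝ}
    (smul_left : ∀ (c : ℂ) v u, q (c • v) u = starRingEnd ℂ c * q v u)
    (smul_right : ∀ (c : ℂ) v u, q v (c • u) = c * q v u)
    (bd : ∀ v u, ‖q v u‖ ≤ C * ((‖v‖ ^ 2 + ‖u‖ ^ 2) / 2)) (v u : W) :
    ‖q v u‖ ≤ C * ‖v‖ * ‖u‖ := by
  rcases eq_or_ne v 0 with rfl | hv
  · have := smul_left 0 0 u
    simp at this; simp [this]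
  rcases eq_or_ne u 0 with rfl | hu
  · have := smul_right 0 v 0
    simp at this; simp [this]
  have hv' := norm_pos_iff.2 hv
  have hu' := norm_pos_iff.2 hu
  have h := bd (((‖v‖⁻¹ : ℝ) : ℂ) • v) (((‖u‖⁻¹ : ℝ) : ℂ) • u)
  rw [smul_left, smul_right, norm_mul, norm_mul, norm_smul, norm_smul, RCLike.norm_conj,
    Complex.norm_real, Complex.norm_real, norm_inv, norm_inv, norm_norm, norm_norm,
    inv_mul_cancel₀ hv'.ne', inv_mul_cancel₀ hu'.ne'] at h
  norm_num at h
  calc ‖q v u‖ = (‖v‖⁻¹ * (‖u‖⁻¹ * ‖q v u‖)) * (‖v‖ * ‖u‖) := by field_simp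
    _ ≤ C * (‖v‖ * ‖u‖) := mul_le_mul_of_nonneg_right h (by positivity)
    _ = _ := by ring

theorem inner_e_left (n : ℕ) (u : Fock) : inner ℂ (e n) u = u n := by
  rw [e, lp.inner_single_left]; simp

theorem measurable_hasSum {α : Type*} [MeasurableSpace α] {f : ℕ → α → ℂ} {h : α → ℂ}
    (hf : ∀ n, Measurable (f n)) (hs : ∀ a, HasSum (fun n => f n a) (h a)) : Measurable h := by
  refine measurable_of_tendsto_metrizable
    (f := fun N a => ∑ n ∈ Finset.range N, f n a) (fun N => ?_) ?_
  · exact Finset.measurable_fun_sum _ fun n _ => hf n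
  · exact tendsto_pi_nhds.2 fun a => (hs a).tendsto_sum_nat

theorem measurable_pairing {α : Type*} [MeasurableSpace α] {a b : α → Fock}
    {S : α → (Fock →L[ℂ] Fock)} (ha : ∀ n, Measurable fun z => a z n)
    (hb : ∀ n, Measurable fun z => b z n)
    (hS : ∀ j k, Measurable fun z => inner ℂ (e j) (S z (e k))) :
    Measurable fun z => inner ℂ (a z) (S z (b z)) := by
  have h1 : ∀ k, Measurable fun z => inner ℂ (a z) (S z (e k)) := fun k => by
    refine measurable_hasSum
      (f := fun n z => inner ℂ (e n) (S z (e k)) * starRingEnd ℂ (a z n)) (fun n => ?_) (fun z => ?_)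
    · have := ha n
      have := hS n k
      fun_prop
    · refine (lp.hasSum_inner (a z) (S z (e k))).congr_fun fun n => ?_
      rw [inner_e_left]; rfl
  refine measurable_hasSum (f := fun n z => b z n * inner ℂ (a z) (S z (e n)))
    (fun n => (hb n).mul (h1 n)) (fun z => ?_)
  have h2 := ((hasSum_e (b z)).mapL (S z)).mapL (innerSL ℂ (a z))
  refine h2.congr_fun fun n => ?_
  simp

namespace Params
variable (p : Params)

theorem hasSum_energy (w : domN) :
    HasSum (fun n => 2 * (p.g n).re * ‖(w : Fock) n‖ ^ 2) (∑ l, ‖p.L l w‖ ^ 2) := by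
  have hB : HasSum (fun n => p.omega n * ‖(w : Fock) n‖ ^ 2) (‖p.B w‖ ^ 2) := by
    rw [← hasSum_nat_add_iff' 1]
    have h := hasSum_norm_sq (p.B w)
    have h0 : p.omega 0 = 0 := by simp [omega]
    simp only [Finset.range_one, Finset.sum_singleton, h0, zero_mul, sub_zero]
    refine h.congr_fun fun n => ?_
    change _ = ‖(√(p.omega (n + 1)) : ℂ) * (w : Fock) (n + 1)‖ ^ 2
    rw [norm_mul, mul_pow, Complex.norm_real, Real.norm_eq_abs, sq_abs,
      Real.sq_sqrt (p.omega_nonneg _)]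
  have hD : HasSum (fun n => p.omega (n + 1) * ‖(w : Fock) n‖ ^ 2) (‖p.Bdag w‖ ^ 2) := by
    have h := (hasSum_nat_add_iff' 1).2 (hasSum_norm_sq (p.Bdag w))
    have h1 : ∀ n, ‖p.Bdag w n‖ ^ 2 = p.omega n * ‖(w : Fock) (n - 1)‖ ^ 2 := fun n => by
      change ‖(√(p.omega n) : ℂ) * (w : Fock) (n - 1)‖ ^ 2 = _
      rw [norm_mul, mul_pow, Complex.norm_real, Real.norm_eq_abs, sq_abs,
        Real.sq_sqrt (p.omega_nonneg _)]
    have h0 : p.omega 0 = 0 := by simp [omega]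
    simpa [h1, h0] using h
  have h := (hB.mul_left (p.mu ^ 2)).add (hD.mul_left (p.lam ^ 2))
  have hs : ∑ l, ‖p.L l w‖ ^ 2 = p.mu ^ 2 * ‖p.B w‖ ^ 2 + p.lam ^ 2 * ‖p.Bdag w‖ ^ 2 := by
    have h0 : p.L 0 w = (p.mu : ℂ) • p.B w := rfl
    have h1 : p.L 1 w = (p.lam : ℂ) • p.Bdag w := rfl
    rw [Fin.sum_univ_two, h0, h1, norm_smul, norm_smul, mul_pow, mul_pow, Complex.norm_real,
      Complex.norm_real, Real.norm_eq_abs, Real.norm_eq_abs, sq_abs, sq_abs]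
  rw [hs]
  refine h.congr_fun fun n => ?_
  rw [g_re]; ring

theorem norm_Pdom_apply (t : ℝ≥0) (w : domN) (n : ℕ) :
    ‖(p.Pdom t w : Fock) n‖ ^ 2 = Real.exp (-2 * t * (p.g n).re) * ‖(w : Fock) n‖ ^ 2 := by
  change ‖p.P t w n‖ ^ 2 = _
  rw [P_apply, norm_mul, norm_exp, mul_pow, ← Real.exp_nat_mul]
  congr 2; push_cast; ring

theorem norm_L_P_le (t : ℝ≥0) (w : domN) :
    ∑ l, ‖p.L l (p.Pdom t w)‖ ^ 2 ≤ ∑ l, ‖p.L l w‖ ^ 2 := by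
  refine hasSum_le (fun n => ?_) (p.hasSum_energy _) (p.hasSum_energy w)
  have := p.g_re_nonneg n
  have h := p.norm_P_apply_le t w n
  change 2 * (p.g n).re * ‖p.P t w n‖ ^ 2 ≤ _
  gcongr

theorem norm_L_P_le' (t : ℝ≥0) (w : domN) (l : Fin 2) :
    ‖p.L l (p.Pdom t w)‖ ≤ √(∑ l, ‖p.L l w‖ ^ 2) := by
  refine Real.le_sqrt_of_sq_le (le_trans ?_ (p.norm_L_P_le t w))
  exact Finset.single_le_sum (f := fun l => ‖p.L l (p.Pdom t w)‖ ^ 2)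
    (fun l _ => by positivity) (Finset.mem_univ l)

theorem coe_sub_toNNReal {t : ℝ≥0} {s : ℝ} (hs : s ∈ Set.Ioc (0 : ℝ) t) :
    ((t - s.toNNReal : ℝ≥0) : ℝ) = t - s := by
  rw [NNReal.coe_sub, Real.coe_toNNReal _ hs.1.le]
  exact Real.toNNReal_le_iff_le_coe.2 hs.2

theorem integral_energy (t : ℝ≥0) (w : domN) :
    ∫ s in (0 : ℝ)..t, ∑ l, ‖p.L l (p.Pdom (t - s.toNNReal) w)‖ ^ 2
      = ‖(w : Fock)‖ ^ 2 - ‖p.P t w‖ ^ 2 := by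
  have h1 : HasSum (fun n => ∫ s in (0 : ℝ)..t,
      2 * (p.g n).re * (Real.exp (-2 * (t - s) * (p.g n).re) * ‖(w : Fock) n‖ ^ 2))
      (∫ s in (0 : ℝ)..t, ∑ l, ‖p.L l (p.Pdom (t - s.toNNReal) w)‖ ^ 2) := by
    refine intervalIntegral.hasSum_integral_of_dominated_convergence
      (fun n _ => 2 * (p.g n).re * ‖(w : Fock) n‖ ^ 2) (fun n => ?_) (fun n => ?_) ?_ ?_ ?_
    · exact Continuous.aestronglyMeasurable (by fun_prop)
    · refine Eventually.of_forall fun s hs => ?_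
      rw [Set.uIoc_of_le t.coe_nonneg] at hs
      have hg := p.g_re_nonneg n
      rw [Real.norm_of_nonneg (by positivity)]
      have : Real.exp (-2 * (t - s) * (p.g n).re) ≤ 1 := by
        rw [Real.exp_le_one_iff]
        nlinarith [mul_nonneg (sub_nonneg.2 hs.2) hg]
      have := mul_le_of_le_one_left (sq_nonneg ‖(w : Fock) n‖) this
      gcongr
    · exact Eventually.of_forall fun s _ => (p.hasSum_energy w).summable
    · exact intervalIntegrable_const
    · refine Eventually.of_forall fun s hs => ?_
      rw [Set.uIoc_of_le t.coe_nonneg] at hs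
      refine (p.hasSum_energy (p.Pdom (t - s.toNNReal) w)).congr_fun fun n => ?_
      rw [norm_Pdom_apply, coe_sub_toNNReal hs]
  have h2 := (hasSum_norm_sq (w : Fock)).sub (hasSum_norm_sq (p.P t w))
  refine h1.unique (h2.congr_fun fun n => ?_)
  have h3 : ‖p.P t w n‖ ^ 2 = _ := p.norm_Pdom_apply t w n
  rw [h3]
  have hd : ∀ s ∈ Set.uIcc (0 : ℝ) t, HasDerivAt
      (fun s : ℝ => Real.exp (-2 * (t - s) * (p.g n).re) * ‖(w : Fock) n‖ ^ 2)
      (2 * (p.g n).re * (Real.exp (-2 * (t - s) * (p.g n).re) * ‖(w : Fock) n‖ ^ 2)) s := by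
    intro s _
    have : HasDerivAt (fun s : ℝ => -2 * (t - s) * (p.g n).re) (2 * (p.g n).re) s := by
      have := (((hasDerivAt_id s).const_sub (t : ℝ)).const_mul (-2)).mul_const (p.g n).re
      simpa using this
    have h4 := this.exp.mul_const (‖(w : Fock) n‖ ^ 2)
    have h5 : ∀ a b c : ℝ, a * b * c = b * (a * c) := fun a b c => by ring
    rwa [h5] at h4
  rw [intervalIntegral.integral_eq_sub_of_hasDerivAt hd
    (Continuous.intervalIntegrable (by fun_prop) _ _)]
  simp

theorem measurable_coord (w : domN) (l : Fin 2) (n : ℕ) :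
    Measurable fun t : ℝ≥0 => p.L l (p.Pdom t w) n := by
  fin_cases l
  · change Measurable fun t : ℝ≥0 => (p.mu : ℂ) * ((√(p.omega (n + 1)) : ℂ) *
      (Complex.exp (-(t : ℂ) * p.g (n + 1)) * (w : Fock) (n + 1)))
    fun_prop
  · change Measurable fun t : ℝ≥0 => (p.lam : ℂ) * ((√(p.omega n) : ℂ) *
      (Complex.exp (-(t : ℂ) * p.g (n - 1)) * (w : Fock) (n - 1)))
    fun_prop

/-- Families of operators for which the integrals of the Lindblad equation make sense. -/
structure Good (C : ℝ) (S : ℝ≥0 → (Fock →L[ℂ] Fock)) : Prop where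
  meas : ∀ j k, Measurable fun s => inner ℂ (e j) (S s (e k))
  bound : ∀ s, ‖S s‖ ≤ C

/-- The integrand of the Lindblad equation. -/
def integrand (S : ℝ≥0 → (Fock →L[ℂ] Fock)) (t : ℝ≥0) (l : Fin 2) (v u : domN) (s : ℝ) : ℂ :=
  inner ℂ (p.L l (p.Pdom (t - s.toNNReal) v))
        (S s.toNNReal (p.L l (p.Pdom (t - s.toNNReal) u)))

variable {p} {C : ℝ} {S : ℝ≥0 → (Fock →L[ℂ] Fock)}

theorem Good.measurable (hS : Good C S) (l : Fin 2) (v u : domN) :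
    Measurable fun z : ℝ≥0 × ℝ => p.integrand S z.1 l v u z.2 := by
  refine measurable_pairing (fun n => ?_) (fun n => ?_) (fun j k => ?_)
  · exact (p.measurable_coord v l n).comp (by fun_prop)
  · exact (p.measurable_coord u l n).comp (by fun_prop)
  · exact (hS.meas j k).comp (by fun_prop)

theorem Good.norm_integrand_le (hS : Good C S) (t : ℝ≥0) (l : Fin 2) (v u : domN) (s : ℝ) :
    ‖p.integrand S t l v u s‖ ≤ C * (‖p.L l (p.Pdom (t - s.toNNReal) v)‖ *
      ‖p.L l (p.Pdom (t - s.toNNReal) u)‖) := by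
  refine (norm_inner_le_norm _ _).trans ?_
  have := (S s.toNNReal).le_of_opNorm_le (hS.bound _) (p.L l (p.Pdom (t - s.toNNReal) u))
  calc _ ≤ ‖p.L l (p.Pdom (t - s.toNNReal) v)‖ *
      (C * ‖p.L l (p.Pdom (t - s.toNNReal) u)‖) := by gcongr
    _ = _ := by ring

theorem Good.nonneg (hS : Good C S) : 0 ≤ C := (norm_nonneg _).trans (hS.bound 0)

theorem Good.integrable (hS : Good C S) (t : ℝ≥0) (l : Fin 2) (v u : domN) :
    IntervalIntegrable (p.integrand S t l v u) volume 0 t := by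
  have hm : Measurable (p.integrand S t l v u) := by
    refine measurable_pairing (fun n => ?_) (fun n => ?_) (fun j k => ?_)
    · exact (p.measurable_coord v l n).comp (by fun_prop)
    · exact (p.measurable_coord u l n).comp (by fun_prop)
    · exact (hS.meas j k).comp (by fun_prop)
  refine (intervalIntegrable_const (c := C * (√(∑ l, ‖p.L l v‖ ^ 2) *
    √(∑ l, ‖p.L l u‖ ^ 2)))).mono_fun hm.aestronglyMeasurable ?_
  refine Eventually.of_forall fun s => ?_
  have := hS.nonneg
  rw [Real.norm_of_nonneg (by positivity)]
  refine (hS.norm_integrand_le t l v u s).trans ?_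
  have h1 := p.norm_L_P_le' (t - s.toNNReal) v l
  have h2 := p.norm_L_P_le' (t - s.toNNReal) u l
  exact mul_le_mul_of_nonneg_left (mul_le_mul h1 h2 (norm_nonneg _) (Real.sqrt_nonneg _)) this

theorem good_id : Good 1 (fun _ => ContinuousLinearMap.id ℂ Fock) :=
  ⟨fun _ _ => measurable_const, fun _ => ContinuousLinearMap.norm_id_le⟩

theorem integrand_id (t : ℝ≥0) (l : Fin 2) (u : domN) (s : ℝ) :
    (p.integrand (fun _ => ContinuousLinearMap.id ℂ Fock) t l u u s).re
      = ‖p.L l (p.Pdom (t - s.toNNReal) u)‖ ^ 2 := by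
  simp only [integrand, ContinuousLinearMap.id_apply, inner_self_eq_norm_sq_to_K]
  norm_cast

theorem integrable_energy (t : ℝ≥0) (l : Fin 2) (u : domN) :
    IntervalIntegrable (fun s => ‖p.L l (p.Pdom (t - s.toNNReal) u)‖ ^ 2) volume 0 t := by
  have h := (good_id.integrable (p := p) t l u u)
  simp_rw [← integrand_id]
  exact ⟨h.1.re, h.2.re⟩

variable (p) in
/-- The integral part of the Lindblad equation. -/
def J (S : ℝ≥0 → (Fock →L[ℂ] Fock)) (t : ℝ≥0) (v u : domN) : ℂ :=
  ∑ l : Fin 2, ∫ s in (0 : ℝ)..t, p.integrand S t l v u s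

theorem lindbladForm_eq (x : Fock →L[ℂ] Fock) (t : ℝ≥0) (v u : domN) :
    p.lindbladForm x S t v u = inner ℂ (p.P t v) (x (p.P t u)) + p.J S t v u := rfl

theorem J_conj (hS : Good C S) (t : ℝ≥0) (v u : domN) :
    ‖p.J S t v u‖ ≤ C * ((‖v‖ ^ 2 - ‖p.P t v‖ ^ 2 + (‖u‖ ^ 2 - ‖p.P t u‖ ^ 2)) / 2) := by
  have h1 : ∀ l, ‖∫ s in (0 : ℝ)..t, p.integrand S t l v u s‖ ≤
      ∫ s in (0 : ℝ)..t, C * ((‖p.L l (p.Pdom (t - s.toNNReal) v)‖ ^ 2 +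
        ‖p.L l (p.Pdom (t - s.toNNReal) u)‖ ^ 2) / 2) := fun l => by
    refine intervalIntegral.norm_integral_le_of_norm_le t.2 (Eventually.of_forall fun s _ => ?_) ?_
    · refine (hS.norm_integrand_le t l v u s).trans ?_
      have := hS.nonneg
      gcongr
      nlinarith [sq_nonneg (‖p.L l (p.Pdom (t - s.toNNReal) v)‖ -
        ‖p.L l (p.Pdom (t - s.toNNReal) u)‖)]
    · exact (((integrable_energy t l v).add (integrable_energy t l u)).div_const 2).const_mul C
  refine (norm_sum_le _ _).trans ((Finset.sum_le_sum fun l _ => h1 l).trans (le_of_eq ?_))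
  have h2 := p.integral_energy t v
  have h3 := p.integral_energy t u
  rw [intervalIntegral.integral_finsetSum (fun l _ => integrable_energy t l _)] at h2 h3
  simp only [Submodule.coe_norm, ← h2, ← h3]
  rw [← Finset.sum_add_distrib, Finset.sum_div, Finset.mul_sum]
  refine Finset.sum_congr rfl fun l _ => ?_
  rw [intervalIntegral.integral_const_mul, intervalIntegral.integral_div,
    intervalIntegral.integral_add (integrable_energy t l v) (integrable_energy t l u)]

end Params

namespace Params
variable {p : Params} {C : ℝ} {S : ℝ≥0 → (Fock →L[ℂ] Fock)}

theorem norm_P_le (t : ℝ≥0) (u : Fock) : ‖p.P t u‖ ^ 2 ≤ ‖u‖ ^ 2 :=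
  hasSum_le (fun n => by have := p.norm_P_apply_le t u n; gcongr)
    (hasSum_norm_sq _) (hasSum_norm_sq u)

theorem Pdom_add (t : ℝ≥0) (u v : domN) : p.Pdom t (u + v) = p.Pdom t u + p.Pdom t v :=
  Subtype.ext ((p.P t).map_add _ _)

theorem Pdom_smul (t : ℝ≥0) (c : ℂ) (u : domN) : p.Pdom t (c • u) = c • p.Pdom t u :=
  Subtype.ext ((p.P t).map_smul _ _)

theorem J_add_left (hS : Good C S) (t : ℝ≥0) (v w u : domN) :
    p.J S t (v + w) u = p.J S t v u + p.J S t w u := by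
  simp only [J, ← Finset.sum_add_distrib]
  refine Finset.sum_congr rfl fun l _ => ?_
  rw [← intervalIntegral.integral_add (hS.integrable t l v u) (hS.integrable t l w u)]
  refine intervalIntegral.integral_congr fun s _ => ?_
  simp only [integrand, Pdom_add, map_add, inner_add_left]

theorem J_add_right (hS : Good C S) (t : ℝ≥0) (v w u : domN) :
    p.J S t v (w + u) = p.J S t v w + p.J S t v u := by
  simp only [J, ← Finset.sum_add_distrib]
  refine Finset.sum_congr rfl fun l _ => ?_
  rw [← intervalIntegral.integral_add (hS.integrable t l v w) (hS.integrable t l v u)]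
  refine intervalIntegral.integral_congr fun s _ => ?_
  simp only [integrand, Pdom_add, map_add, inner_add_right]

theorem J_smul_left (t : ℝ≥0) (c : ℂ) (v u : domN) :
    p.J S t (c • v) u = starRingEnd ℂ c * p.J S t v u := by
  simp only [J, Finset.mul_sum, ← intervalIntegral.integral_const_mul]
  simp only [integrand, Pdom_smul, map_smul, inner_smul_left]

theorem J_smul_right (t : ℝ≥0) (c : ℂ) (v u : domN) :
    p.J S t v (c • u) = c * p.J S t v u := by
  simp only [J, Finset.mul_sum, ← intervalIntegral.integral_const_mul]
  simp only [integrand, Pdom_smul, map_smul, inner_smul_right]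

theorem J_sub {C' : ℝ} {S' : ℝ≥0 → (Fock →L[ℂ] Fock)} (hS : Good C S) (hS' : Good C' S')
    (t : ℝ≥0) (v u : domN) :
    p.J (fun s => S s - S' s) t v u = p.J S t v u - p.J S' t v u := by
  simp only [J, ← Finset.sum_sub_distrib]
  refine Finset.sum_congr rfl fun l _ => ?_
  rw [← intervalIntegral.integral_sub (hS.integrable t l v u) (hS'.integrable t l v u)]
  refine intervalIntegral.integral_congr fun s _ => ?_
  simp only [integrand, _root_.sub_apply, inner_sub_right]

theorem Good.sub {C' : ℝ} {S' : ℝ≥0 → (Fock →L[ℂ] Fock)} (hS : Good C S) (hS' : Good C' S') :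
    Good (C + C') (fun s => S s - S' s) where
  meas j k := by
    simp only [_root_.sub_apply, inner_sub_right]
    exact (hS.meas j k).sub (hS'.meas j k)
  bound s := (norm_sub_le _ _).trans (add_le_add (hS.bound s) (hS'.bound s))

theorem measurable_J (hS : Good C S) (v u : domN) : Measurable fun t => p.J S t v u := by
  refine Finset.measurable_fun_sum _ fun l _ => ?_
  let F : ℝ≥0 → ℝ → ℂ := fun t s => (Set.Ioc (0 : ℝ) t).indicator (p.integrand S t l v u) s
  have hF : Measurable (Function.uncurry F) := by
    have hset : MeasurableSet {z : ℝ≥0 × ℝ | 0 < z.2 ∧ z.2 ≤ (z.1 : ℝ)} :=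
      (measurableSet_lt measurable_const measurable_snd).inter
        (measurableSet_le measurable_snd (by fun_prop))
    have h := (hS.measurable (p := p) l v u).indicator hset
    exact h
  have h := (StronglyMeasurable.integral_prod_right (ν := volume) hF.stronglyMeasurable).measurable
  have heq : (fun t : ℝ≥0 => ∫ s in (0 : ℝ)..t, p.integrand S t l v u s)
      = fun t => ∫ s, F t s := by
    funext t
    simp only [F]
    rw [intervalIntegral.integral_of_le t.coe_nonneg, integral_indicator measurableSet_Ioc]
  rw [heq]
  exact h

theorem measurable_P_coord (u : Fock) (n : ℕ) : Measurable fun t => p.P t u n := by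
  simp only [P_apply]
  fun_prop

theorem exists_step (x : Fock →L[ℂ] Fock) (hS : Good ‖x‖ S) :
    ∃ S' : ℝ≥0 → (Fock →L[ℂ] Fock), Good ‖x‖ S' ∧ ∀ t (v u : domN),
      inner ℂ (v : Fock) (S' t u) = p.lindbladForm x S t v u := by
  have key : ∀ t, ∃ A : Fock →L[ℂ] Fock, (∀ v u : domN,
      inner ℂ (v : Fock) (A u) = p.lindbladForm x S t v u) ∧ ‖A‖ ≤ ‖x‖ := fun t => by
    have sl : ∀ (c : ℂ) v u, p.lindbladForm x S t (c • v) u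
        = starRingEnd ℂ c * p.lindbladForm x S t v u := fun c v u => by
      simp only [lindbladForm_eq, J_smul_left, Submodule.coe_smul, map_smul, inner_smul_left,
        mul_add]
    have sr : ∀ (c : ℂ) v u, p.lindbladForm x S t v (c • u)
        = c * p.lindbladForm x S t v u := fun c v u => by
      simp only [lindbladForm_eq, J_smul_right, Submodule.coe_smul, map_smul, inner_smul_right,
        mul_add]
    refine exists_op dense_domN _ (norm_nonneg x) (fun v w u => ?_) sl (fun v w u => ?_) sr
      (form_bound _ sl sr fun v u => ?_)
    · simp only [lindbladForm_eq, J_add_left hS, Submodule.coe_add, map_add, inner_add_left]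
      ring
    · simp only [lindbladForm_eq, J_add_right hS, Submodule.coe_add, map_add, inner_add_right]
      ring
    · rw [lindbladForm_eq]
      refine (norm_add_le _ _).trans ?_
      have h1 := J_conj (p := p) hS t v u
      have h2 : ‖inner ℂ (p.P t v) (x (p.P t u))‖ ≤
          ‖x‖ * ((‖p.P t v‖ ^ 2 + ‖p.P t u‖ ^ 2) / 2) := by
        refine (norm_inner_le_norm _ _).trans ?_
        have h3 := x.le_opNorm (p.P t u)
        calc _ ≤ ‖p.P t v‖ * (‖x‖ * ‖p.P t u‖) := by gcongr
          _ = ‖x‖ * (‖p.P t v‖ * ‖p.P t u‖) := by ring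
          _ ≤ _ := by
            gcongr
            nlinarith [sq_nonneg (‖p.P t v‖ - ‖p.P t u‖)]
      calc _ ≤ _ := add_le_add h2 h1
        _ = _ := by ring
  choose S' h1 h2 using key
  refine ⟨S', ⟨fun j k => ?_, h2⟩, h1⟩
  have h3 : ∀ t, inner ℂ (e j) (S' t (e k)) = _ := fun t => h1 t ⟨e j, e_mem j⟩ ⟨e k, e_mem k⟩
  simp only [h3, lindbladForm_eq]
  exact (measurable_pairing (measurable_P_coord _) (measurable_P_coord _)
    (fun _ _ => measurable_const)).add (measurable_J hS _ _)

theorem good_zero (x : Fock →L[ℂ] Fock) :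
    Good ‖x‖ (fun t => (p.P t).adjoint ∘L x ∘L p.P t) where
  meas j k := by
    simp only [ContinuousLinearMap.comp_apply, ContinuousLinearMap.adjoint_inner_right]
    exact measurable_pairing (measurable_P_coord _) (measurable_P_coord _)
      (fun _ _ => measurable_const)
  bound s := by
    have h : ‖p.P s‖ ≤ 1 := ContinuousLinearMap.opNorm_le_bound _ zero_le_one fun u => by
      rw [one_mul]; exact le_of_sq_le_sq (norm_P_le s u) (norm_nonneg _)
    have h1 : ‖(p.P s).adjoint‖ ≤ 1 := by simpa using h
    calc _ ≤ ‖(p.P s).adjoint‖ * (‖x‖ * ‖p.P s‖) :=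
          (ContinuousLinearMap.opNorm_comp_le _ _).trans
            (mul_le_mul_of_nonneg_left (ContinuousLinearMap.opNorm_comp_le _ _) (norm_nonneg _))
      _ ≤ 1 * (‖x‖ * 1) := by gcongr
      _ = ‖x‖ := by ring

variable (p) in
theorem exists_isPicard (x : Fock →L[ℂ] Fock) :
    ∃ S, p.IsPicard x S ∧ ∀ n, Good ‖x‖ (S n) := by
  let X := {S : ℝ≥0 → (Fock →L[ℂ] Fock) // Good ‖x‖ S}
  let step : X → X := fun S =>
    ⟨Classical.choose (exists_step (p := p) x S.2),
      (Classical.choose_spec (exists_step (p := p) x S.2)).1⟩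
  let seq : ℕ → X := fun n => Nat.rec ⟨_, good_zero (p := p) x⟩ (fun _ S => step S) n
  exact ⟨fun n => (seq n).1, ⟨fun t => rfl, fun n t v u =>
    (Classical.choose_spec (exists_step (p := p) x (seq n).2)).2 t v u⟩, fun n => (seq n).2⟩

theorem J_dominated {C' K : ℝ} {D D' : ℝ≥0 → (Fock →L[ℂ] Fock)}
    (hD' : Good C' D') (h : ∀ s u v, ‖inner ℂ v (D s u)‖ ≤
      K * ((inner ℂ v (D' s v)).re + (inner ℂ u (D' s u)).re)) (t : ℝ≥0) (v u : domN) :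
    ‖p.J D t v u‖ ≤ K * ((p.J D' t v v).re + (p.J D' t u u).re) := by
  have hi : ∀ l (u : domN), IntervalIntegrable (fun s => (p.integrand D' t l u u s).re)
      volume 0 t := fun l u => by
    have := hD'.integrable (p := p) t l u u
    exact ⟨this.1.re, this.2.re⟩
  have hre : ∀ u : domN, (p.J D' t u u).re =
      ∑ l, ∫ s in (0 : ℝ)..t, (p.integrand D' t l u u s).re := fun u => by
    rw [J, Complex.re_sum]
    refine Finset.sum_congr rfl fun l _ => ?_
    exact (Complex.reCLM.intervalIntegral_comp_comm (hD'.integrable t l u u)).symm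
  rw [hre, hre, ← Finset.sum_add_distrib, Finset.mul_sum]
  refine (norm_sum_le _ _).trans (Finset.sum_le_sum fun l _ => ?_)
  rw [← intervalIntegral.integral_add (hi l v) (hi l u), ← intervalIntegral.integral_const_mul]
  refine intervalIntegral.norm_integral_le_of_norm_le t.2 (Eventually.of_forall fun s _ => ?_)
    (((hi l v).add (hi l u)).const_mul K)
  exact h _ _ _

/-- The successive differences of a sequence of operator families. -/
def diff (S : ℕ → ℝ≥0 → (Fock →L[ℂ] Fock)) : ℕ → ℝ≥0 → (Fock →L[ℂ] Fock)
  | 0 => S 0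
  | n + 1 => fun t => S (n + 1) t - S n t

theorem good_diff {S : ℕ → ℝ≥0 → (Fock →L[ℂ] Fock)} (hS : ∀ n, Good C (S n)) (n : ℕ) :
    Good (C + C) (diff S n) := by
  cases n with
  | zero => exact ⟨(hS 0).meas, fun s => ((hS 0).bound s).trans (by linarith [(hS 0).nonneg])⟩
  | succ n => exact (hS (n + 1)).sub (hS n)

theorem inner_diff {x : Fock →L[ℂ] Fock} {S : ℕ → ℝ≥0 → (Fock →L[ℂ] Fock)}
    (h : p.IsPicard x S) (hS : ∀ n, Good C (S n)) (n : ℕ) (t : ℝ≥0) (v u : domN) :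
    inner ℂ (v : Fock) (diff S (n + 1) t u) = p.J (diff S n) t v u := by
  cases n with
  | zero =>
    simp only [diff, _root_.sub_apply, inner_sub_right, h.succ, lindbladForm_eq]
    simp only [h.zero, ContinuousLinearMap.comp_apply, ContinuousLinearMap.adjoint_inner_right]
    ring
  | succ n =>
    simp only [diff, _root_.sub_apply, inner_sub_right, h.succ, lindbladForm_eq]
    rw [J_sub (hS (n + 1)) (hS n)]
    ring

theorem diff_le {x : Fock →L[ℂ] Fock} {S S' : ℕ → ℝ≥0 → (Fock →L[ℂ] Fock)} {C' : ℝ}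
    (h : p.IsPicard x S) (hS : ∀ n, Good C (S n))
    (h' : p.IsPicard (ContinuousLinearMap.id ℂ Fock) S') (hS' : ∀ n, Good C' (S' n)) (n : ℕ) :
    ∀ t u v, ‖inner ℂ v (diff S n t u)‖ ≤
      ‖x‖ / 2 * ((inner ℂ v (diff S' n t v)).re + (inner ℂ u (diff S' n t u)).re) := by
  induction n with
  | zero =>
    intro t u v
    simp only [diff, h.zero, h'.zero, ContinuousLinearMap.comp_apply,
      ContinuousLinearMap.adjoint_inner_right, ContinuousLinearMap.id_apply]
    have h0 : ∀ w : Fock, (inner ℂ w w).re = ‖w‖ ^ 2 := fun w => by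
      rw [inner_self_eq_norm_sq_to_K]; norm_cast
    rw [h0, h0]
    refine (norm_inner_le_norm _ _).trans ?_
    have h3 := x.le_opNorm (p.P t u)
    calc _ ≤ ‖p.P t v‖ * (‖x‖ * ‖p.P t u‖) := by gcongr
      _ = ‖x‖ / 2 * (2 * ‖p.P t v‖ * ‖p.P t u‖) := by ring
      _ ≤ _ := by
        gcongr
        nlinarith [sq_nonneg (‖p.P t v‖ - ‖p.P t u‖)]
  | succ n ih =>
    intro t
    refine isClosed_property2 (e := ((↑) : domN → Fock)) ?_ ?_ fun u v => ?_
    · simpa [DenseRange] using dense_domN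
    · exact isClosed_le (by fun_prop) (by fun_prop)
    · rw [inner_diff h hS, inner_diff h' hS', inner_diff h' hS']
      exact J_dominated (good_diff hS' n) ih t v u

theorem sum_diff (S : ℕ → ℝ≥0 → (Fock →L[ℂ] Fock)) (n : ℕ) (t : ℝ≥0) :
    ∑ k ∈ Finset.range (n + 1), diff S k t = S n t := by
  induction n with
  | zero => simp [diff]
  | succ n ih => rw [Finset.sum_range_succ, ih, diff]; simp

variable (p) in
theorem exists_limit (t : ℝ≥0) (x : Fock →L[ℂ] Fock) : ∃ A : Fock →L[ℂ] Fock,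
    ∃ S, p.IsPicard x S ∧
      ∀ v u, Tendsto (fun n => inner ℂ v (S n t u)) atTop (𝓝 (inner ℂ v (A u))) := by
  obtain ⟨S, h, hS⟩ := p.exists_isPicard x
  obtain ⟨S', h', hS'⟩ := p.exists_isPicard (ContinuousLinearMap.id ℂ Fock)
  have hle := fun n => diff_le h hS h' hS' n
  have hnn : ∀ n u, 0 ≤ (inner ℂ u (diff S' n t u)).re := fun n u => by
    rcases eq_or_lt_of_le (norm_nonneg (ContinuousLinearMap.id ℂ Fock)) with h0 | h0
    · have h1 := diff_le h' hS' h' hS' n t u u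
      rw [← h0] at h1
      have h2 : inner ℂ u (diff S' n t u) = 0 := norm_le_zero_iff.1 (by simpa using h1)
      simp [h2]
    · have h1 := (norm_nonneg _).trans (diff_le h' hS' h' hS' n t u u)
      have h2 := nonneg_of_mul_nonneg_right h1 (by positivity)
      linarith
  have hsum1 : ∀ u, Summable fun n => (inner ℂ u (diff S' n t u)).re := fun u => by
    have hpart : ∀ n, ∑ k ∈ Finset.range (n + 1), (inner ℂ u (diff S' k t u)).re =
        (inner ℂ u (S' n t u)).re := fun n => by
      rw [← sum_diff S' n t, _root_.sum_apply, inner_sum, Complex.re_sum]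
    refine summable_of_sum_range_le (c := ‖u‖ * (‖ContinuousLinearMap.id ℂ Fock‖ * ‖u‖))
      (fun n => hnn n u) (fun n => ?_)
    refine (Finset.sum_le_sum_of_subset_of_nonneg
      (Finset.range_mono n.le_succ) fun k _ _ => hnn k u).trans ?_
    rw [Nat.succ_eq_add_one, hpart]
    refine (Complex.re_le_norm _).trans ((norm_inner_le_norm _ _).trans ?_)
    have := (S' n t).le_of_opNorm_le ((hS' n).bound t) u
    gcongr
  have hlim : ∀ v u, ∃ z, Tendsto (fun n => inner ℂ v (S n t u)) atTop (𝓝 z) := fun v u => by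
    have hs : Summable fun n => inner ℂ v (diff S n t u) :=
      Summable.of_norm_bounded (((hsum1 v).add (hsum1 u)).mul_left (‖x‖ / 2)) fun n => hle n t u v
    refine ⟨_, (hs.hasSum.tendsto_sum_nat.comp (tendsto_add_atTop_nat 1)).congr fun n => ?_⟩
    rw [Function.comp_apply, ← sum_diff S n t, _root_.sum_apply, inner_sum]
  choose q hq using hlim
  obtain ⟨A, hA, -⟩ := exists_op (W := ⊤) (by simp) (fun v u => q v u) (norm_nonneg x)
    (fun v w u => tendsto_nhds_unique (hq _ _) (((hq v u).add (hq w u)).congr fun n => by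
      simp))
    (fun c v u => tendsto_nhds_unique (hq _ _) (((hq v u).const_mul _).congr fun n => by
      simp [mul_comm]))
    (fun v w u => tendsto_nhds_unique (hq _ _) (((hq v w).add (hq v u)).congr fun n => by
      simp))
    (fun c v u => tendsto_nhds_unique (hq _ _) (((hq v u).const_mul _).congr fun n => by
      simp))
    (fun v u => by
      refine le_of_tendsto (hq v u).norm (Eventually.of_forall fun n => ?_)
      refine (norm_inner_le_norm _ _).trans ?_
      have := (S n t).le_of_opNorm_le ((hS n).bound t) (u : Fock)
      calc _ ≤ ‖(v : Fock)‖ * (‖x‖ * ‖(u : Fock)‖) := by gcongr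
        _ = _ := by simp only [Submodule.coe_norm]; ring)
  refine ⟨A, S, h, fun v u => ?_⟩
  have := hA ⟨v, trivial⟩ ⟨u, trivial⟩
  simp only at this
  rw [this]
  exact hq v u

/-- The Picard iterates are determined by `x`. -/
theorem IsPicard.unique {x : Fock →L[ℂ] Fock} {S S' : ℕ → ℝ≥0 → (Fock →L[ℂ] Fock)}
    (h : p.IsPicard x S) (h' : p.IsPicard x S') : S = S' := by
  funext n
  induction n with
  | zero => funext t; rw [h.zero, h'.zero]
  | succ n ih =>
    funext t
    have h1 : ∀ u : domN, S (n + 1) t u = S' (n + 1) t u := fun u => by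
      refine dense_domN.eq_of_inner_right ℂ fun v hv => ?_
      rw [h.succ n t ⟨v, hv⟩ u, h'.succ n t ⟨v, hv⟩ u, ih]
    exact ContinuousLinearMap.ext fun u => congrFun
      (Continuous.ext_on dense_domN (by fun_prop) (by fun_prop) fun w hw => h1 ⟨w, hw⟩) u

variable (p) in
/-- The minimal quantum dynamical semigroup `(𝒯_t)_{t ≥ 0}` on `B(ℓ²(ℕ))` associated with
`G, L₁, L₂`: `𝒯_t(x)` is the weak limit of the Picard iterates of the Lindblad equation
`⟨v, 𝒯_t(x) u⟩ = ⟨v, P_t* x P_t u⟩ + ∑_ℓ ∫₀ᵗ ⟨L_ℓ P_{t-s} v, 𝒯_s(x) L_ℓ P_{t-s} u⟩ ds`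
(for positive `x` the iterates increase). -/
def minimalQDS (t : ℝ≥0) (x : Fock →L[ℂ] Fock) : Fock →L[ℂ] Fock :=
  Classical.choose (p.exists_limit t x)

variable (p) in
/-- The defining property of `minimalQDS`. -/
theorem minimalQDS_spec (t : ℝ≥0) (x : Fock →L[ℂ] Fock) : ∃ S, p.IsPicard x S ∧
    ∀ v u, Tendsto (fun n => inner ℂ v (S n t u)) atTop (𝓝 (inner ℂ v (p.minimalQDS t x u))) :=
  Classical.choose_spec (p.exists_limit t x)

end Params

/-- A bounded operator is strictly positive if it is positive and `⟨u, x u⟩ > 0` for all `u ≠ 0`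
(its inverse may be unbounded). -/
def StrictlyPositive (x : Fock →L[ℂ] Fock) : Prop :=
  x.IsPositive ∧ ∀ u, u ≠ 0 → 0 < (inner ℂ u (x u)).re

/-- The potential form `U(x)[u] = ∫₀^∞ ⟨u, T_t(x) u⟩ dt` of a positive operator `x`. -/
def potential (T : ℝ≥0 → (Fock →L[ℂ] Fock) → (Fock →L[ℂ] Fock)) (x : Fock →L[ℂ] Fock)
    (u : Fock) : ℝ≥0∞ :=
  ∫⁻ t in Set.Ici (0 : ℝ), ENNReal.ofReal (inner ℂ u (T t.toNNReal x u)).re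

/-- A positive operator is integrable for a semigroup if its potential form is bounded. -/
def HasBoundedPotential (T : ℝ≥0 → (Fock →L[ℂ] Fock) → (Fock →L[ℂ] Fock))
    (x : Fock →L[ℂ] Fock) : Prop :=
  x.IsPositive ∧ ∃ C : ℝ≥0, ∀ u, potential T x u ≤ C * ENNReal.ofReal (‖u‖ ^ 2)

/-- A semigroup is transient if there is a strictly positive operator with bounded potential. -/
def IsTransient (T : ℝ≥0 → (Fock →L[ℂ] Fock) → (Fock →L[ℂ] Fock)) : Prop :=
  ∃ x, StrictlyPositive x ∧ HasBoundedPotential T x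

/-- The trace of an operator (of trace class), in the canonical basis. -/
def trace (A : Fock →L[ℂ] Fock) : ℂ := ∑' n, inner ℂ (e n) (A (e n))

/-- Density matrices, i.e. normal states: positive operators of trace class and trace one. -/
def IsDensityMatrix (ρ : Fock →L[ℂ] Fock) : Prop :=
  ρ.IsPositive ∧ HasSum (fun n => inner ℂ (e n) (ρ (e n))) 1

/-- The normal state with density matrix `ρ` is invariant: `tr(ρ T_t(x)) = tr(ρ x)`. -/
def IsInvariant (T : ℝ≥0 → (Fock →L[ℂ] Fock) → (Fock →L[ℂ] Fock))
    (ρ : Fock →L[ℂ] Fock) : Prop :=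
  ∀ t x, trace (ρ ∘L T t x) = trace (ρ ∘L x)

/-- An operator is superharmonic if it is positive and `T_t(x) ≤ x` for all `t ≥ 0`. -/
def IsSuperharmonic (T : ℝ≥0 → (Fock →L[ℂ] Fock) → (Fock →L[ℂ] Fock))
    (x : Fock →L[ℂ] Fock) : Prop :=
  x.IsPositive ∧ ∀ t, (x - T t x).IsPositive

end QuadOsc

end

/-! Diagonal operators are preserved by the Picard iteration: `B` and `B⁺` shift the basis by one
step, so the iteration maps diagonals to diagonals, and squared moduli of `exp (-t g)` remove the
phases coming from ζ⁺, ζ⁻. On the diagonal it is the Picard iteration for the backward equation of a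
birth-death process with birth rate λ²ω_{k+1} and death rate μ²ω_k (`IsPicard.inner_e`). All three
claims can be tested on diagonal operators.

For λ = μ the generator has divergence form: it sends f to λ²[ω_{k+1}(f_{k+1} - f_k) - ω_k(f_k -
f_{k-1})]. A prescribed flux ω_{k+1}(f_{k+1} - f_k) = -w_k is realised by f = `tail w`, which
converges for bounded w because ω_k grows like k². The generator then gives -λ²(w_k - w_{k-1}), with
w_{-1} = 0 (`jump_tail_zero`, `jump_tail_succ`). The weight w = 1 yields the operator X; a strictly
increasing bounded positive w yields -h with h > 0 everywhere.

The bridge to the semigroup is `classicalPicard_add_integral_le`, a Lyapunov estimate: if the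
generator sends f ≥ 0 below -h, then the evolution of f plus the time integral of the evolution of h
stays below f. With h = 0 this is superharmonicity; with h > 0 it bounds the potential of diag(h) by
sup f = f_0, which is transience. An invariant normal state would give diag(h) an expectation that
is positive and constant in time, so its time integral would diverge, contrary to the bounded
potential. -/

noncomputable section

open MeasureTheory Filter Topology
open scoped NNReal ENNReal

namespace QuadOsc
namespace Params

/-! ### The birth-death process on the diagonal and its Picard iterates. -/

variable (p : Params)

/-- The total jump rate out of `k` of the classical birth-death process obtained by restricting
the semigroup to diagonal operators. -/
def rate (k : ℕ) : ℝ := p.lam ^ 2 * p.omega (k + 1) + p.mu ^ 2 * p.omega k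

/-- The off-diagonal part of the generator of the birth-death process. -/
def jump (f : ℕ → ℝ) (k : ℕ) : ℝ :=
  p.mu ^ 2 * p.omega k * f (k - 1) + p.lam ^ 2 * p.omega (k + 1) * f (k + 1)

theorem rate_eq (k : ℕ) : p.rate k = 2 * (p.g k).re := by
  rw [g_re, rate]; ring

theorem jump_mono {f f' : ℕ → ℝ} (h : ∀ k, f k ≤ f' k) (k : ℕ) : p.jump f k ≤ p.jump f' k := by
  have h1 := mul_nonneg (sq_nonneg p.mu) (p.omega_nonneg k)
  have h2 := mul_nonneg (sq_nonneg p.lam) (p.omega_nonneg (k + 1))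
  exact add_le_add (mul_le_mul_of_nonneg_left (h _) h1) (mul_le_mul_of_nonneg_left (h _) h2)

theorem jump_zero (k : ℕ) : p.jump (fun _ => 0) k = 0 := by simp [jump]

/-- The Picard iterates of the backward equation of the birth-death process, started from `0`. -/
def classicalPicard (f : ℕ → ℝ) : ℕ → ℝ → ℕ → ℝ
  | 0, _, _ => 0
  | n + 1, t, k => Real.exp (-t * p.rate k) *
      (f k + ∫ s in (0 : ℝ)..t, Real.exp (s * p.rate k) * p.jump (classicalPicard f n s) k)

variable {p} {f h : ℕ → ℝ}

theorem continuous_jump {φ : ℝ → ℕ → ℝ} (hφ : ∀ k, Continuous fun t => φ t k) (k : ℕ) :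
    Continuous fun t => p.jump (φ t) k := by
  have h1 := hφ (k - 1)
  have h2 := hφ (k + 1)
  simp only [jump]
  fun_prop

theorem continuous_classicalPicard (n k : ℕ) :
    Continuous fun t => p.classicalPicard f n t k := by
  induction n generalizing k with
  | zero => exact continuous_const
  | succ n ih =>
    have h1 := continuous_jump (p := p) ih k
    have h2 : Continuous fun s : ℝ => Real.exp (s * p.rate k) *
        p.jump (p.classicalPicard f n s) k := by fun_prop
    have h3 := intervalIntegral.continuous_primitive (fun a b => h2.intervalIntegrable a b) 0
      (μ := volume)
    simp only [classicalPicard]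
    fun_prop

/-- The factor exp(-t rate) stands outside the integral, so the integrand does not depend on t and
the product rule suffices. The result is the backward equation with its inflow taken from the
previous iterate. -/
theorem hasDerivAt_classicalPicard (n k : ℕ) (t : ℝ) :
    HasDerivAt (fun t => p.classicalPicard f (n + 1) t k)
      (-p.rate k * p.classicalPicard f (n + 1) t k + p.jump (p.classicalPicard f n t) k) t := by
  have h1 := continuous_jump (p := p) (continuous_classicalPicard (p := p) (f := f) n) k
  have h2 : Continuous fun s : ℝ => Real.exp (s * p.rate k) *
      p.jump (p.classicalPicard f n s) k := by fun_prop
  have h3 := (intervalIntegral.integral_hasDerivAt_right (h2.intervalIntegrable 0 t)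
    h2.stronglyMeasurable.stronglyMeasurableAtFilter h2.continuousAt).const_add (f k)
  have h4 : HasDerivAt (fun t : ℝ => Real.exp (-t * p.rate k))
      (Real.exp (-t * p.rate k) * (-1 * p.rate k)) t :=
    ((hasDerivAt_id t).neg.mul_const _).exp
  have h5 : Real.exp (-t * p.rate k) * Real.exp (t * p.rate k) = 1 := by
    rw [← Real.exp_add]; simp
  refine (h4.mul h3).congr_deriv ?_
  simp only [classicalPicard]
  linear_combination p.jump (p.classicalPicard f n t) k * h5

theorem classicalPicard_zero_time (n k : ℕ) : p.classicalPicard f (n + 1) 0 k = f k := by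
  simp [classicalPicard]

theorem classicalPicard_nonneg (hf : ∀ k, 0 ≤ f k) (n : ℕ) {t : ℝ} (ht : 0 ≤ t) (k : ℕ) :
    0 ≤ p.classicalPicard f n t k := by
  induction n generalizing t k with
  | zero => exact le_rfl
  | succ n ih =>
    refine mul_nonneg (Real.exp_pos _).le (add_nonneg (hf k) ?_)
    refine intervalIntegral.integral_nonneg ht fun s hs => mul_nonneg (Real.exp_pos _).le ?_
    rw [← p.jump_zero k]
    exact p.jump_mono (fun k => ih hs.1 k) k

/-! ### The Lyapunov estimate for the iterates. -/

/-- Integrating factor: exp(qt) G(t) is nonincreasing on t ≥ 0 and starts at G(0) ≤ 0. -/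
theorem nonpos_of_deriv_add_mul_nonpos {G G' : ℝ → ℝ} {q : ℝ} (hG : ∀ t, HasDerivAt G (G' t) t)
    (h0 : G 0 ≤ 0) (h : ∀ t, 0 ≤ t → G' t + q * G t ≤ 0) {t : ℝ} (ht : 0 ≤ t) : G t ≤ 0 := by
  have hd : ∀ t, HasDerivAt (fun t => Real.exp (t * q) * G t)
      (Real.exp (t * q) * (G' t + q * G t)) t := fun t => by
    have h1 : HasDerivAt (fun t : ℝ => Real.exp (t * q)) (Real.exp (t * q) * (1 * q)) t :=
      ((hasDerivAt_id t).mul_const q).exp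
    exact (h1.mul (hG t)).congr_deriv (by ring)
  have hanti : AntitoneOn (fun t => Real.exp (t * q) * G t) (Set.Ici 0) := by
    refine antitoneOn_of_deriv_nonpos (convex_Ici 0)
      (fun t _ => (hd t).continuousAt.continuousWithinAt)
      (fun t _ => (hd t).differentiableAt.differentiableWithinAt) fun t ht => ?_
    rw [interior_Ici] at ht
    rw [(hd t).deriv]
    exact mul_nonpos_of_nonneg_of_nonpos (Real.exp_pos _).le (h t (le_of_lt ht))
  have h1 := hanti (Set.self_mem_Ici) ht ht
  simp only [zero_mul, Real.exp_zero, one_mul] at h1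
  exact nonpos_of_mul_nonpos_right (h1.trans h0) (Real.exp_pos _)

/-- If `f ≥ 0` and the generator maps `f` below `-h`, then `f` dominates the iterates started at
`f` plus the occupation integral of the iterates started at `h`. -/
theorem classicalPicard_add_integral_le (hf : ∀ k, 0 ≤ f k)
    (hfh : ∀ k, p.jump f k + h k ≤ p.rate k * f k) (n : ℕ) {t : ℝ} (ht : 0 ≤ t) (k : ℕ) :
    p.classicalPicard f n t k + ∫ s in (0 : ℝ)..t, p.classicalPicard h n s k ≤ f k := by
  induction n generalizing t k with
  | zero => simpa [classicalPicard] using hf k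
  | succ n ih =>
    have hc := fun n k => continuous_classicalPicard (p := p) (f := h) n k
    have hint : ∀ n k t, IntervalIntegrable (fun s => p.classicalPicard h n s k) volume 0 t :=
      fun n k t => (hc n k).intervalIntegrable 0 t
    have hj := continuous_jump (p := p) (fun k => hc n k) k
    have hψ : ∀ t, HasDerivAt (fun t => ∫ s in (0 : ℝ)..t, p.classicalPicard h (n + 1) s k)
        (p.classicalPicard h (n + 1) t k) t := fun t =>
      intervalIntegral.integral_hasDerivAt_right (hint _ _ t)
        (hc _ k).stronglyMeasurable.stronglyMeasurableAtFilter (hc _ k).continuousAt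
    have hG := fun t => ((hasDerivAt_classicalPicard (p := p) (f := f) n k t).add
      (hψ t)).sub_const (f k)
    -- The backward equation for the h-iterate, integrated in time. `jump` involves only two
    -- neighbours, so the integral passes through it.
    have hduhamel : ∀ t, p.classicalPicard h (n + 1) t k = h k
        - p.rate k * (∫ s in (0 : ℝ)..t, p.classicalPicard h (n + 1) s k)
        + p.jump (fun j => ∫ s in (0 : ℝ)..t, p.classicalPicard h n s j) k := fun t => by
      have h1 := intervalIntegral.integral_eq_sub_of_hasDerivAt (a := 0) (b := t)
        (fun s _ => hasDerivAt_classicalPicard (p := p) (f := h) n k s)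
        ((((hc (n + 1) k).const_mul _).add hj).intervalIntegrable _ _)
      rw [intervalIntegral.integral_add (((hint _ _ _).const_mul _))
        (hj.intervalIntegrable _ _), intervalIntegral.integral_const_mul,
        classicalPicard_zero_time] at h1
      simp only [jump] at h1 ⊢
      rw [intervalIntegral.integral_add ((hint _ _ _).const_mul _) ((hint _ _ _).const_mul _),
        intervalIntegral.integral_const_mul, intervalIntegral.integral_const_mul] at h1
      linarith
    have := nonpos_of_deriv_add_mul_nonpos (q := p.rate k) hG
      (by simp [classicalPicard_zero_time]) (fun t ht => ?_) ht
    · simpa using this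
    -- For G = (f-iterate) + ∫(h-iterate) - f, substituting `hduhamel` turns G' + rate·G into `jump`
    -- of the level-n sum, plus h, minus rate·f. By induction and monotonicity of `jump` this is at
    -- most jump f + h - rate·f ≤ 0.
    · have h1 := hduhamel t
      have h2 := p.jump_mono (fun j => ih ht j) k
      have h3 := hfh k
      have h4 : p.jump (fun j => p.classicalPicard f n t j +
          ∫ s in (0 : ℝ)..t, p.classicalPicard h n s j) k = p.jump (p.classicalPicard f n t) k +
          p.jump (fun j => ∫ s in (0 : ℝ)..t, p.classicalPicard h n s j) k := by
        simp only [jump]; ring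
      simp only [Pi.add_apply] at *
      linarith

/-! ### Quantum Picard iterates of a diagonal operator. -/

theorem L_zero_Pdom_e (t : ℝ≥0) (k : ℕ) : p.L 0 (p.Pdom t ⟨e k, e_mem k⟩) =
    ((p.mu : ℂ) * √(p.omega k) * Complex.exp (-(t : ℂ) * p.g k)) • e (k - 1) := by
  ext n
  change (p.mu : ℂ) * ((√(p.omega (n + 1)) : ℂ) *
    (Complex.exp (-(t : ℂ) * p.g (n + 1)) * e k (n + 1))) = _ * e (k - 1) n
  -- For k = 0 the truncated index makes the vector on the right e₀, but its coefficient vanishes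
  -- because ω₀ = 0.
  rcases k with _ | k
  · simp [e_apply, omega]
  · by_cases hn : n = k
    · subst hn; simp [e_apply]; ring
    · simp [e_apply, hn]

theorem L_one_Pdom_e (t : ℝ≥0) (k : ℕ) : p.L 1 (p.Pdom t ⟨e k, e_mem k⟩) =
    ((p.lam : ℂ) * √(p.omega (k + 1)) * Complex.exp (-(t : ℂ) * p.g k)) • e (k + 1) := by
  ext n
  change (p.lam : ℂ) * ((√(p.omega n) : ℂ) *
    (Complex.exp (-(t : ℂ) * p.g (n - 1)) * e k (n - 1))) = _ * e (k + 1) n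
  rcases n with _ | n
  · simp [e_apply, omega]
  · by_cases hn : n = k
    · subst hn; simp [e_apply]; ring
    · simp [e_apply, hn]

theorem P_e (t : ℝ≥0) (k : ℕ) : p.P t (e k) = Complex.exp (-(t : ℂ) * p.g k) • e k := by
  ext n
  change Complex.exp (-(t : ℂ) * p.g n) * e k n = _ * e k n
  by_cases hn : n = k
  · rw [hn]
  · simp [e_apply, hn]

/-- A squared modulus sees only 2 Re g, which is the jump rate; the ζ⁺ and ζ⁻ terms disappear here.
-/
theorem conj_mul_exp (a t : ℝ) (k : ℕ) :
    (starRingEnd ℂ) ((a : ℂ) * Complex.exp (-(t : ℂ) * p.g k)) *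
      ((a : ℂ) * Complex.exp (-(t : ℂ) * p.g k)) =
      ((a ^ 2 * Real.exp (-t * p.rate k) : ℝ) : ℂ) := by
  rw [← Complex.normSq_eq_conj_mul_self, Complex.normSq_eq_norm_sq, norm_mul, mul_pow,
    Complex.norm_real, Real.norm_eq_abs, sq_abs, Complex.norm_exp, ← Real.exp_nat_mul]
  congr 3
  simp [rate_eq]; ring

theorem integrand_e_zero (S : ℝ≥0 → (Fock →L[ℂ] Fock)) (t : ℝ≥0) (j k : ℕ) (s : ℝ) :
    p.integrand S t 0 ⟨e j, e_mem j⟩ ⟨e k, e_mem k⟩ s =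
      (starRingEnd ℂ ((p.mu * √(p.omega j) : ℝ) *
        Complex.exp (-((t - s.toNNReal : ℝ≥0) : ℂ) * p.g j)) *
      ((p.mu * √(p.omega k) : ℝ) * Complex.exp (-((t - s.toNNReal : ℝ≥0) : ℂ) * p.g k))) *
        inner ℂ (e (j - 1)) (S s.toNNReal (e (k - 1))) := by
  rw [integrand, L_zero_Pdom_e, L_zero_Pdom_e, map_smul, inner_smul_left, inner_smul_right]
  push_cast
  ring

theorem integrand_e_one (S : ℝ≥0 → (Fock →L[ℂ] Fock)) (t : ℝ≥0) (j k : ℕ) (s : ℝ) :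
    p.integrand S t 1 ⟨e j, e_mem j⟩ ⟨e k, e_mem k⟩ s =
      (starRingEnd ℂ ((p.lam * √(p.omega (j + 1)) : ℝ) *
        Complex.exp (-((t - s.toNNReal : ℝ≥0) : ℂ) * p.g j)) *
      ((p.lam * √(p.omega (k + 1)) : ℝ) *
        Complex.exp (-((t - s.toNNReal : ℝ≥0) : ℂ) * p.g k))) *
        inner ℂ (e (j + 1)) (S s.toNNReal (e (k + 1))) := by
  rw [integrand, L_one_Pdom_e, L_one_Pdom_e, map_smul, inner_smul_left, inner_smul_right]
  push_cast
  ring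

/-- The Picard iterates of a diagonal operator are diagonal, with entries the iterates of the
birth-death process. -/
theorem IsPicard.inner_e {x : Fock →L[ℂ] Fock} {S : ℕ → ℝ≥0 → (Fock →L[ℂ] Fock)}
    (hS : p.IsPicard x S) (hx : ∀ k, x (e k) = (f k : ℂ) • e k) (n : ℕ) (t : ℝ≥0) (j k : ℕ) :
    inner ℂ (e j) (S n t (e k)) = if j = k then (p.classicalPicard f (n + 1) t k : ℂ) else 0 := by
  have h0 : ∀ (t : ℝ≥0) (j k : ℕ), inner ℂ (p.P t (e j)) (x (p.P t (e k))) =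
      if j = k then ((Real.exp (-t * p.rate k) * f k : ℝ) : ℂ) else 0 := fun t j k => by
    rw [P_e, P_e, map_smul, hx, inner_smul_left, inner_smul_right, inner_smul_right, inner_e_left,
      e_apply]
    split_ifs with hjk
    · subst hjk
      have := conj_mul_exp (p := p) 1 t j
      simp only [Complex.ofReal_one, one_mul, one_pow] at this
      rw [mul_one, ← mul_assoc]
      push_cast at this ⊢
      rw [← this]
    · simp
  induction n generalizing t j k with
  -- The index shift: the quantum iteration starts from P_t* x P_t, which is already the first
  -- classical iterate, since the classical one starts from 0.
  | zero =>
    rw [hS.zero]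
    simp only [ContinuousLinearMap.comp_apply, ContinuousLinearMap.adjoint_inner_right]
    rw [h0]
    simp [classicalPicard, jump]
  | succ n ih =>
    have hs := hS.succ n t ⟨e j, e_mem j⟩ ⟨e k, e_mem k⟩
    simp only at hs
    rw [hs, lindbladForm_eq]
    simp only
    rw [h0, J, Fin.sum_univ_two]
    simp only [integrand_e_zero, integrand_e_one]
    by_cases hjk : j = k
    · subst hjk
      simp only [if_true]
      -- On (0, t] the truncated difference t - s is the true one, so exp(-(t-s) rate) splits into
      -- the two factors used in `classicalPicard`.
      have hexp : ∀ s ∈ Set.Ioc (0 : ℝ) t, ∀ a : ℝ,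
          (starRingEnd ℂ) ((a : ℂ) * Complex.exp (-((t - s.toNNReal : ℝ≥0) : ℂ) * p.g j)) *
            ((a : ℂ) * Complex.exp (-((t - s.toNNReal : ℝ≥0) : ℂ) * p.g j)) =
            ((a ^ 2 * (Real.exp (-t * p.rate j) * Real.exp (s * p.rate j)) : ℝ) : ℂ) :=
        fun s hs a => by
          have := conj_mul_exp (p := p) a ((t - s.toNNReal : ℝ≥0) : ℝ) j
          rw [coe_sub_toNNReal hs] at this
          rw [← Real.exp_add, ← add_mul, neg_add_eq_sub, ← neg_sub, ← this, ← coe_sub_toNNReal hs]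
      have hc : ∀ i, Continuous fun s => Real.exp (s * p.rate j) *
          p.classicalPicard f (n + 1) s i := fun i => by
        have := continuous_classicalPicard (p := p) (f := f) (n + 1) i
        fun_prop
      have hI : ∀ (a : ℝ) (i : ℕ), ∫ s in (0 : ℝ)..t,
          (starRingEnd ℂ) ((a : ℂ) * Complex.exp (-((t - s.toNNReal : ℝ≥0) : ℂ) * p.g j)) *
            ((a : ℂ) * Complex.exp (-((t - s.toNNReal : ℝ≥0) : ℂ) * p.g j)) *
            inner ℂ (e i) (S n s.toNNReal (e i)) =
          ((a ^ 2 * Real.exp (-t * p.rate j) * ∫ s in (0 : ℝ)..t,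
            Real.exp (s * p.rate j) * p.classicalPicard f (n + 1) s i : ℝ) : ℂ) := fun a i => by
        rw [← intervalIntegral.integral_const_mul, ← intervalIntegral.integral_ofReal]
        refine intervalIntegral.integral_congr_ae (Eventually.of_forall fun s hs => ?_)
        rw [Set.uIoc_of_le t.coe_nonneg] at hs
        rw [hexp s hs, ih, if_pos rfl, Real.coe_toNNReal _ hs.1.le]
        push_cast
        ring
      rw [hI, hI, ← Complex.ofReal_add, ← Complex.ofReal_add]
      congr 1
      rw [mul_pow, mul_pow, Real.sq_sqrt (p.omega_nonneg _), Real.sq_sqrt (p.omega_nonneg _),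
        classicalPicard]
      have hsplit : ∫ s in (0 : ℝ)..t, Real.exp (s * p.rate j) *
          p.jump (p.classicalPicard f (n + 1) s) j =
          p.mu ^ 2 * p.omega j * (∫ s in (0 : ℝ)..t, Real.exp (s * p.rate j) *
            p.classicalPicard f (n + 1) s (j - 1)) +
          p.lam ^ 2 * p.omega (j + 1) * (∫ s in (0 : ℝ)..t, Real.exp (s * p.rate j) *
            p.classicalPicard f (n + 1) s (j + 1)) := by
        rw [← intervalIntegral.integral_const_mul, ← intervalIntegral.integral_const_mul,
          ← intervalIntegral.integral_add (((hc _).const_mul _).intervalIntegrable _ _)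
            (((hc _).const_mul _).intervalIntegrable _ _)]
        refine intervalIntegral.integral_congr fun s _ => ?_
        simp only [jump]
        ring
      rw [hsplit]
      ring
    · have h1 : ∀ s : ℝ, inner ℂ (e (j + 1)) (S n s.toNNReal (e (k + 1))) = 0 := fun s => by
        rw [ih, if_neg (by omega)]
      -- Lowering two distinct indices keeps them distinct unless truncation at 0 intervenes, as for
      -- (0, 1); there the factor √ω₀ = 0 kills the term.
      have h2 : ∀ s : ℝ, (starRingEnd ℂ ((p.mu * √(p.omega j) : ℝ) *
          Complex.exp (-((t - s.toNNReal : ℝ≥0) : ℂ) * p.g j)) *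
          ((p.mu * √(p.omega k) : ℝ) * Complex.exp (-((t - s.toNNReal : ℝ≥0) : ℂ) * p.g k))) *
          inner ℂ (e (j - 1)) (S n s.toNNReal (e (k - 1))) = 0 := fun s => by
        rcases j with _ | j
        · simp [omega]
        · rcases k with _ | k
          · simp [omega]
          · rw [ih, if_neg (by omega), mul_zero]
      simp only [h1, h2, hjk, mul_zero, if_false, intervalIntegral.integral_zero, add_zero]

variable {x : Fock →L[ℂ] Fock}

/-- The diagonal entries of the minimal semigroup at `x`. -/
theorem tendsto_classicalPicard (hx : ∀ k, x (e k) = (f k : ℂ) • e k) (t : ℝ≥0) (k : ℕ) :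
    Tendsto (fun n => p.classicalPicard f (n + 1) t k) atTop
      (𝓝 (inner ℂ (e k) (p.minimalQDS t x (e k))).re) := by
  obtain ⟨S, hS, hlim⟩ := p.minimalQDS_spec t x
  refine ((Complex.continuous_re.tendsto _).comp (hlim (e k) (e k))).congr fun n => ?_
  simp [hS.inner_e hx]

/-- Every iterate is diagonal with real entries, and both properties survive the weak limit of
matrix entries. Thus the semigroup keeps such operators diagonal. -/
theorem minimalQDS_e (hx : ∀ k, x (e k) = (f k : ℂ) • e k) (t : ℝ≥0) (k : ℕ) :
    p.minimalQDS t x (e k) =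
      ((inner ℂ (e k) (p.minimalQDS t x (e k))).re : ℂ) • e k := by
  obtain ⟨S, hS, hlim⟩ := p.minimalQDS_spec t x
  ext j
  rw [← inner_e_left]
  have h1 := hlim (e j) (e k)
  simp only [hS.inner_e hx] at h1
  change _ = _ * e k j
  rw [e_apply]
  split_ifs with hjk
  · subst hjk
    simp only [if_true] at h1
    rw [mul_one]
    exact tendsto_nhds_unique h1
      ((Complex.continuous_ofReal.tendsto _).comp (tendsto_classicalPicard hx t j))
  · simp only [hjk, if_false] at h1
    rw [mul_zero]
    exact tendsto_nhds_unique h1 tendsto_const_nhds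

end Params

/-! ### Bounded diagonal operators on ℓ²(ℕ). -/

/-- Diagonal operators act coordinatewise. -/
theorem apply_of_diagonal {x : Fock →L[ℂ] Fock} {f : ℕ → ℝ}
    (hx : ∀ k, x (e k) = (f k : ℂ) • e k) (u : Fock) (n : ℕ) : x u n = f n * u n := by
  have h1 := ((hasSum_e u).mapL x).mapL (innerSL ℂ (e n))
  simp only [innerSL_apply_apply, inner_e_left, map_smul, hx] at h1
  refine h1.unique ?_
  convert hasSum_single n fun k hk => ?_ using 1
  · simp [e_apply]; ring
  · simp [e_apply, hk.symm]

theorem hasSum_inner_of_diagonal {x : Fock →L[ℂ] Fock} {f : ℕ → ℝ}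
    (hx : ∀ k, x (e k) = (f k : ℂ) • e k) (u : Fock) :
    HasSum (fun n => f n * ‖u n‖ ^ 2) (inner ℂ u (x u)).re := by
  have h1 := Complex.hasSum_re (lp.hasSum_inner u (x u))
  refine h1.congr_fun fun n => ?_
  rw [apply_of_diagonal hx]
  have : inner ℂ (u n) ((f n : ℂ) * u n) = ((f n * ‖u n‖ ^ 2 : ℝ) : ℂ) := by
    rw [← smul_eq_mul, inner_smul_right, inner_self_eq_norm_sq_to_K]
    push_cast; rfl
  rw [this, Complex.ofReal_re]

theorem isPositive_of_diagonal {x : Fock →L[ℂ] Fock} {f : ℕ → ℝ}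
    (hx : ∀ k, x (e k) = (f k : ℂ) • e k) (hf : ∀ k, 0 ≤ f k) : x.IsPositive := by
  refine ⟨fun u v => ?_, fun u => ?_⟩
  · refine (lp.hasSum_inner (x u) v).unique ((lp.hasSum_inner u (x v)).congr_fun fun n => ?_)
    simp only [apply_of_diagonal hx]
    simp [mul_assoc, mul_left_comm]
  · rw [ContinuousLinearMap.reApplyInnerSelf_apply, inner_re_symm]
    exact (hasSum_inner_of_diagonal hx u).nonneg fun n => mul_nonneg (hf n) (sq_nonneg _)

theorem strictlyPositive_of_diagonal {x : Fock →L[ℂ] Fock} {f : ℕ → ℝ}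
    (hx : ∀ k, x (e k) = (f k : ℂ) • e k) (hf : ∀ k, 0 < f k) : StrictlyPositive x := by
  refine ⟨isPositive_of_diagonal hx fun k => (hf k).le, fun u hu => ?_⟩
  obtain ⟨n, hn⟩ : ∃ n, u n ≠ 0 := by
    by_contra! h
    exact hu (lp.ext (funext h))
  have h1 := hasSum_inner_of_diagonal hx u
  have h2 := h1.summable.sum_le_tsum {n} fun k _ => mul_nonneg (hf k).le (sq_nonneg _)
  rw [h1.tsum_eq, Finset.sum_singleton] at h2
  have := hf n
  have := norm_pos_iff.2 hn
  exact lt_of_lt_of_le (by positivity) h2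

theorem exists_diagonal {f : ℕ → ℝ} {C : ℝ} (hf : ∀ k, |f k| ≤ C) :
    ∃ x : Fock →L[ℂ] Fock, ∀ k, x (e k) = (f k : ℂ) • e k := by
  have hC : 0 ≤ C := (abs_nonneg _).trans (hf 0)
  have hle : ∀ (u : Fock) n, ‖(f n : ℂ) * u n‖ ^ 2 ≤ C ^ 2 * ‖u n‖ ^ 2 := fun u n => by
    rw [norm_mul, mul_pow, Complex.norm_real, Real.norm_eq_abs]
    have := hf n
    gcongr
  let x : Fock →ₗ[ℂ] Fock :=
    { toFun := fun u => ⟨fun n => (f n : ℂ) * u n, (memlp_iff _).2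
        (Summable.of_nonneg_of_le (fun n => by positivity) (hle u)
          ((hasSum_norm_sq u).summable.mul_left _))⟩
      map_add' := fun u v => by ext n; exact mul_add _ _ _
      map_smul' := fun c u => by ext n; exact mul_left_comm _ _ _ }
  have hx : ∀ u, ‖x u‖ ≤ C * ‖u‖ := fun u => by
    refine le_of_sq_le_sq ?_ (mul_nonneg hC (norm_nonneg u))
    rw [mul_pow]
    exact hasSum_le (hle u) (hasSum_norm_sq (x u)) ((hasSum_norm_sq u).mul_left (C ^ 2))
  refine ⟨x.mkContinuous C hx, fun k => ?_⟩
  · ext n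
    change (f n : ℂ) * e k n = f k * e k n
    by_cases hn : n = k
    · rw [hn]
    · simp [e_apply, hn]

/-! ### Superharmonicity and potentials from inequalities for the birth-death generator. -/

namespace Params

variable {p : Params} {f h : ℕ → ℝ} {x : Fock →L[ℂ] Fock}

/-- The difference x - T_t(x) is diagonal, so its positivity is entrywise. Each iterate started at f
stays below f by the Lyapunov estimate with h = 0, and so does the limit. -/
theorem isSuperharmonic_of_diagonal (hx : ∀ k, x (e k) = (f k : ℂ) • e k) (hf : ∀ k, 0 ≤ f k)
    (hsup : ∀ k, p.jump f k ≤ p.rate k * f k) : IsSuperharmonic p.minimalQDS x := by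
  refine ⟨isPositive_of_diagonal hx hf, fun t => ?_⟩
  refine isPositive_of_diagonal
    (f := fun k => f k - (inner ℂ (e k) (p.minimalQDS t x (e k))).re) (fun k => ?_) fun k => ?_
  · rw [_root_.sub_apply, hx, minimalQDS_e hx t k, ← sub_smul, ← minimalQDS_e hx t k]
    push_cast; rfl
  · refine sub_nonneg.2 (le_of_tendsto (tendsto_classicalPicard hx t k)
      (Eventually.of_forall fun n => ?_))
    have h1 := classicalPicard_add_integral_le (p := p) (h := fun _ => 0) hf
      (fun k => by simpa using hsup k) (n + 1) t.coe_nonneg k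
    have h2 : 0 ≤ ∫ s in (0 : ℝ)..t, p.classicalPicard (fun _ => 0) (n + 1) s k :=
      intervalIntegral.integral_nonneg t.coe_nonneg fun s hs =>
        classicalPicard_nonneg (fun _ => le_rfl) _ hs.1 k
    linarith

/-- A pointwise limit of continuous functions of time; needed to exchange time integrals with sums
over k. -/
theorem measurable_entry (hx : ∀ k, x (e k) = (h k : ℂ) • e k) (k : ℕ) :
    Measurable fun t : ℝ => (inner ℂ (e k) (p.minimalQDS t.toNNReal x (e k))).re := by
  refine measurable_of_tendsto_metrizable
    (f := fun n (t : ℝ) => p.classicalPicard h (n + 1) t.toNNReal k) (fun n => ?_)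
    (tendsto_pi_nhds.2 fun t => tendsto_classicalPicard hx _ k)
  exact ((continuous_classicalPicard (n + 1) k).measurable.comp
    (by fun_prop : Measurable fun t : ℝ => (t.toNNReal : ℝ)))

/-- The Lyapunov estimate bounds the integral of each iterate over [0, N] by f, uniformly in N and
in the iterate. Exhaustion N → ∞ and then Fatou's lemma carry the bound to the semigroup, so no
monotonicity of the iterates is needed. -/
theorem potential_e_le (hx : ∀ k, x (e k) = (h k : ℂ) • e k) (hf : ∀ k, 0 ≤ f k)
    (hh : ∀ k, 0 ≤ h k) (hfh : ∀ k, p.jump f k + h k ≤ p.rate k * f k) (k : ℕ) :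
    potential p.minimalQDS x (e k) ≤ ENNReal.ofReal (f k) := by
  have hbound : ∀ n, ∫⁻ t in Set.Ici (0 : ℝ),
      ENNReal.ofReal (p.classicalPicard h (n + 1) t.toNNReal k) ≤ ENNReal.ofReal (f k) := by
    intro n
    have hc := continuous_classicalPicard (p := p) (f := h) (n + 1) k
    rw [setLIntegral_congr Ioi_ae_eq_Ici.symm]
    have hT : Tendsto (fun N : ℕ => ∫⁻ t in Set.Ioc (0 : ℝ) N,
        ENNReal.ofReal (p.classicalPicard h (n + 1) t.toNNReal k)) atTop
        (𝓝 (∫⁻ t in Set.Ioi (0 : ℝ),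
          ENNReal.ofReal (p.classicalPicard h (n + 1) t.toNNReal k))) := by
      have hU : (⋃ N : ℕ, Set.Ioc (0 : ℝ) N) = Set.Ioi 0 := by
        ext t
        simp only [Set.mem_iUnion, Set.mem_Ioc, Set.mem_Ioi]
        exact ⟨fun ⟨_, h, _⟩ => h, fun h => (exists_nat_ge t).imp fun N hN => ⟨h, hN⟩⟩
      have hm : Monotone fun N : ℕ => Set.Ioc (0 : ℝ) N := fun a b hab =>
        Set.Ioc_subset_Ioc_right (by exact_mod_cast hab)
      rw [← hU, setLIntegral_iUnion_of_directed _ hm.directed_le]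
      exact tendsto_atTop_iSup fun a b hab => lintegral_mono_set (hm hab)
    refine le_of_tendsto' hT fun N => ?_
    have hnn : ∀ t ∈ Set.Ioc (0 : ℝ) N, 0 ≤ p.classicalPicard h (n + 1) t k :=
      fun t ht => classicalPicard_nonneg hh _ ht.1.le k
    have heq : ∫⁻ t in Set.Ioc (0 : ℝ) N,
        ENNReal.ofReal (p.classicalPicard h (n + 1) t.toNNReal k) =
        ENNReal.ofReal (∫ t in (0 : ℝ)..N, p.classicalPicard h (n + 1) t k) := by
      rw [intervalIntegral.integral_of_le N.cast_nonneg, ofReal_integral_eq_lintegral_ofReal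
        (hc.intervalIntegrable 0 (N : ℝ)).1
        ((ae_restrict_iff' measurableSet_Ioc).2 (Eventually.of_forall hnn))]
      refine setLIntegral_congr_fun measurableSet_Ioc fun t ht => ?_
      simp only [Real.coe_toNNReal _ ht.1.le]
    rw [heq]
    refine ENNReal.ofReal_le_ofReal ?_
    have h1 := classicalPicard_add_integral_le hf hfh (n + 1) (Nat.cast_nonneg N) k
    have h2 := classicalPicard_nonneg (p := p) hf (n + 1) (Nat.cast_nonneg N) k
    linarith
  -- The limit is rewritten as a liminf, the form in which Fatou's lemma applies.
  have hlim : ∀ t : ℝ, ENNReal.ofReal (inner ℂ (e k) (p.minimalQDS t.toNNReal x (e k))).re =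
      liminf (fun n => ENNReal.ofReal (p.classicalPicard h (n + 1) t.toNNReal k)) atTop :=
    fun t => ((ENNReal.continuous_ofReal.tendsto _).comp
      (tendsto_classicalPicard hx t.toNNReal k)).liminf_eq.symm
  simp only [potential, hlim]
  refine (lintegral_liminf_le fun n => ?_).trans ?_
  · exact ((continuous_classicalPicard (n + 1) k).measurable.comp
      (by fun_prop : Measurable fun t : ℝ => (t.toNNReal : ℝ))).ennreal_ofReal
  · exact liminf_le_of_le (by isBoundedDefault) fun _ hb => by
      obtain ⟨n, hn⟩ := hb.exists
      exact hn.trans (hbound n)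

theorem entry_nonneg (hx : ∀ k, x (e k) = (h k : ℂ) • e k) (hh : ∀ k, 0 ≤ h k) (t : ℝ≥0)
    (k : ℕ) : 0 ≤ (inner ℂ (e k) (p.minimalQDS t x (e k))).re :=
  ge_of_tendsto' (tendsto_classicalPicard hx t k)
    fun _ => classicalPicard_nonneg hh _ t.coe_nonneg k

/-- Weighted sums of the diagonal entries have bounded potential. -/
theorem lintegral_tsum_entry_le (hx : ∀ k, x (e k) = (h k : ℂ) • e k) {C : ℝ}
    (hpot : ∀ k, potential p.minimalQDS x (e k) ≤ ENNReal.ofReal C) (w : ℕ → ℝ≥0∞) :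
    ∫⁻ t in Set.Ici (0 : ℝ), ∑' k, ENNReal.ofReal
      (inner ℂ (e k) (p.minimalQDS t.toNNReal x (e k))).re * w k ≤
      ENNReal.ofReal C * ∑' k, w k := by
  have hm := fun k => (measurable_entry (p := p) hx k).ennreal_ofReal
  rw [lintegral_tsum fun k => ((hm k).mul_const _).aemeasurable, ← ENNReal.tsum_mul_left]
  refine ENNReal.tsum_le_tsum fun k => ?_
  rw [lintegral_mul_const _ (hm k)]
  gcongr
  exact hpot k

theorem hasBoundedPotential_of_diagonal (hx : ∀ k, x (e k) = (h k : ℂ) • e k)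
    (hh : ∀ k, 0 ≤ h k) {C : ℝ}
    (hpot : ∀ k, potential p.minimalQDS x (e k) ≤ ENNReal.ofReal C) :
    HasBoundedPotential p.minimalQDS x := by
  refine ⟨isPositive_of_diagonal hx hh, C.toNNReal, fun u => ?_⟩
  -- With these weights the sum is ⟨u, T_t(x) u⟩, because T_t(x) is diagonal; the total weight is
  -- ‖u‖².
  have h1 := lintegral_tsum_entry_le hx hpot fun k => ENNReal.ofReal (‖u k‖ ^ 2)
  rw [← ENNReal.ofReal_tsum_of_nonneg (fun k => sq_nonneg _) (hasSum_norm_sq u).summable,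
    (hasSum_norm_sq u).tsum_eq] at h1
  refine le_trans (le_of_eq (lintegral_congr fun t => ?_)) h1
  have h2 := hasSum_inner_of_diagonal (fun k => minimalQDS_e (p := p) hx t.toNNReal k) u
  rw [← h2.tsum_eq, ENNReal.ofReal_tsum_of_nonneg
    (fun k => mul_nonneg (entry_nonneg hx hh _ k) (sq_nonneg _)) h2.summable]
  exact tsum_congr fun k => ENNReal.ofReal_mul (entry_nonneg hx hh _ k)

end Params

/-! ### Absence of invariant normal states. -/

/-- Against a diagonal operator only the diagonal of ρ matters, even if ρ is not diagonal;
positivity of ρ makes these entries real. -/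
theorem trace_comp_of_diagonal {ρ x : Fock →L[ℂ] Fock} {f : ℕ → ℝ}
    (hρ : ρ.IsPositive) (hx : ∀ k, x (e k) = (f k : ℂ) • e k) :
    trace (ρ ∘L x) = ((∑' k, f k * (inner ℂ (e k) (ρ (e k))).re : ℝ) : ℂ) := by
  rw [trace, Complex.ofReal_tsum]
  refine tsum_congr fun k => ?_
  have h1 : ((inner ℂ (e k) (ρ (e k))).re : ℂ) = inner ℂ (e k) (ρ (e k)) :=
    Complex.ext rfl (Complex.nonneg_iff.1 (hρ.inner_nonneg_right (e k))).2
  rw [ContinuousLinearMap.comp_apply, hx, map_smul, inner_smul_right, Complex.ofReal_mul, h1]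

/-- A strictly positive diagonal operator with bounded potential excludes invariant normal
states. -/
theorem Params.not_exists_invariant {p : Params} {h : ℕ → ℝ} {x : Fock →L[ℂ] Fock}
    (hx : ∀ k, x (e k) = (h k : ℂ) • e k) (hh : ∀ k, 0 < h k) {C : ℝ}
    (hpot : ∀ k, potential p.minimalQDS x (e k) ≤ ENNReal.ofReal C) :
    ¬ ∃ ρ : Fock →L[ℂ] Fock, IsDensityMatrix ρ ∧ IsInvariant p.minimalQDS ρ := by
  rintro ⟨ρ, ⟨hρ, htr⟩, hinv⟩
  set w : ℕ → ℝ := fun k => (inner ℂ (e k) (ρ (e k))).re with hw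
  have hw0 : ∀ k, 0 ≤ w k := fun k => (Complex.nonneg_iff.1 (hρ.inner_nonneg_right (e k))).1
  have hw1 : HasSum w 1 := by simpa using Complex.hasSum_re htr
  have hbd : ∀ (A : Fock →L[ℂ] Fock), Summable fun k => (inner ℂ (e k) (A (e k))).re * w k :=
    fun A => by
      have he : ∀ k, ‖e k‖ = 1 := fun k => by simp [e]
      refine Summable.of_norm_bounded (hw1.summable.mul_left ‖A‖) fun k => ?_
      rw [norm_mul, Real.norm_of_nonneg (hw0 k)]
      refine mul_le_mul_of_nonneg_right ?_ (hw0 k)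
      refine (Complex.abs_re_le_norm _).trans ((norm_inner_le_norm _ _).trans ?_)
      simpa [he] using A.le_opNorm (e k)
  have hx' : ∀ k, (inner ℂ (e k) (x (e k))).re = h k := fun k => by
    rw [hx, inner_smul_right, inner_e_left, e_apply]
    simp
  have hconst : ∀ t, ∑' k, (inner ℂ (e k) (p.minimalQDS t x (e k))).re * w k =
      ∑' k, h k * w k := fun t => by
    have h1 := hinv t x
    rw [trace_comp_of_diagonal hρ hx, trace_comp_of_diagonal hρ (minimalQDS_e hx t)] at h1
    exact_mod_cast h1
  have hpos : 0 < ∑' k, h k * w k := by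
    obtain ⟨k, hk⟩ : ∃ k, w k ≠ 0 := by
      by_contra! h0
      have : HasSum w 0 := by simp [funext h0]
      exact zero_ne_one (this.unique hw1)
    have hs := hbd x
    simp only [hx'] at hs
    exact hs.tsum_pos (fun k => mul_nonneg (hh k).le (hw0 k)) k
      (mul_pos (hh k) (lt_of_le_of_ne (hw0 k) hk.symm))
  -- Weighting by the diagonal of ρ, of total mass 1, bounds the time integral of tr(ρ T_t(x)) by C.
  have h1 := lintegral_tsum_entry_le hx hpot fun k => ENNReal.ofReal (w k)
  have h2 : ∀ t : ℝ, ∑' k, ENNReal.ofReal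
      (inner ℂ (e k) (p.minimalQDS t.toNNReal x (e k))).re * ENNReal.ofReal (w k) =
      ENNReal.ofReal (∑' k, h k * w k) := fun t => by
    have h0 := entry_nonneg (p := p) hx (fun k => (hh k).le) t.toNNReal
    rw [← hconst t.toNNReal, ENNReal.ofReal_tsum_of_nonneg
      (fun k => mul_nonneg (h0 k) (hw0 k)) (hbd _)]
    exact tsum_congr fun k => (ENNReal.ofReal_mul (h0 k)).symm
  simp only [h2] at h1
  -- By invariance the integrand is a positive constant, so its integral over the half-line is
  -- infinite.
  rw [setLIntegral_const, Real.volume_Ici, ENNReal.mul_top (by simpa using hpos),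
    ← ENNReal.ofReal_tsum_of_nonneg hw0 hw1.summable] at h1
  exact absurd h1 (not_le.2 (by finiteness))

/-! ### Explicit solutions for the birth-death generator when λ = μ. -/

namespace Params

variable {p : Params}

theorem omega_succ (k : ℕ) : p.omega (k + 1) = (k + 1) * (k + p.r) := by
  simp only [omega]; push_cast; ring

theorem omega_succ_pos (k : ℕ) : 0 < p.omega (k + 1) := by
  have := p.r_pos
  rw [omega_succ]; positivity

theorem summable_inv_omega (p : Params) : Summable fun k : ℕ => 1 / p.omega (k + 1) := by
  have hr := p.r_pos
  have h1 : Summable fun k : ℕ => 1 / ((k : ℝ) + 1) ^ 2 := by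
    have := (summable_nat_add_iff 1).2 (Real.summable_one_div_nat_pow.2 one_lt_two)
    simpa using this
  -- The constant works for every r > 0, small or large: (1 + 1/r)(k + r) = (k + 1) + (r + k/r) ≥ k
  -- + 1.
  refine Summable.of_nonneg_of_le (fun k => (one_div_pos.2 (omega_succ_pos k)).le) (fun k => ?_)
    (h1.mul_left (1 + 1 / p.r))
  rw [omega_succ, mul_one_div, div_le_div_iff₀ (by positivity) (by positivity)]
  have h2 : (1 + 1 / p.r) * ((k + 1) * (k + p.r)) =
      ((k : ℝ) + 1) ^ 2 + (k + 1) * (p.r + k / p.r) := by field_simp; ring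
  rw [h2]
  have : 0 ≤ ((k : ℝ) + 1) * (p.r + k / p.r) := by positivity
  linarith

/-- Tails of the series `∑ w k / ω (k + 1)`. -/
def tail (p : Params) (w : ℕ → ℝ) (n : ℕ) : ℝ := ∑' k : ℕ, w (n + k) / p.omega (n + k + 1)

section tail

variable {w : ℕ → ℝ}

theorem summable_div_omega (hw0 : ∀ k, 0 < w k) (hw1 : ∀ k, w k ≤ 1) :
    Summable fun k => w k / p.omega (k + 1) :=
  Summable.of_nonneg_of_le (fun k => (div_pos (hw0 k) (omega_succ_pos k)).le)
    (fun k => div_le_div_of_nonneg_right (hw1 k) (omega_succ_pos k).le) p.summable_inv_omega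

theorem summable_tail (hw0 : ∀ k, 0 < w k) (hw1 : ∀ k, w k ≤ 1) (n : ℕ) :
    Summable fun k => w (n + k) / p.omega (n + k + 1) := by
  have := (summable_nat_add_iff n).2 (summable_div_omega (p := p) hw0 hw1)
  simpa only [add_comm n] using this

theorem tail_pos (hw0 : ∀ k, 0 < w k) (hw1 : ∀ k, w k ≤ 1) (n : ℕ) :
    0 < p.tail w n :=
  (summable_tail hw0 hw1 n).tsum_pos
    (fun _ => (div_pos (hw0 _) (omega_succ_pos _)).le) 0 (div_pos (hw0 _) (omega_succ_pos _))

theorem tail_eq (hw0 : ∀ k, 0 < w k) (hw1 : ∀ k, w k ≤ 1) (n : ℕ) :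
    p.tail w n = w n / p.omega (n + 1) + p.tail w (n + 1) := by
  rw [tail, (summable_tail hw0 hw1 n).tsum_eq_zero_add, tail]
  simp only [add_zero, add_comm, add_left_comm]

theorem tail_le (hw0 : ∀ k, 0 < w k) (hw1 : ∀ k, w k ≤ 1) (n : ℕ) :
    p.tail w n ≤ p.tail w 0 := by
  induction n with
  | zero => exact le_rfl
  | succ n ih =>
    have := tail_eq (p := p) hw0 hw1 n
    have := div_pos (hw0 n) (omega_succ_pos (p := p) n)
    linarith

/-- At the boundary ω₀ = 0 leaves only the outgoing flux, as if w had the value 0 at -1. -/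
theorem jump_tail_zero (hw0 : ∀ k, 0 < w k) (hw1 : ∀ k, w k ≤ 1) :
    p.jump (p.tail w) 0 + p.lam ^ 2 * w 0 = p.rate 0 * p.tail w 0 := by
  have h0 : p.omega 0 = 0 := by simp [omega]
  have h1 := (omega_succ_pos (p := p) 0).ne'
  have h2 := tail_eq (p := p) hw0 hw1 0
  simp only [jump, rate, h0, h2]
  field_simp
  ring

/-- Equal birth and death constants make the generator a discrete divergence. The flux of the tail
across the bond from k to k + 1 is -w k, so only the increment of w remains. -/
theorem jump_tail_succ (hw0 : ∀ k, 0 < w k) (hw1 : ∀ k, w k ≤ 1)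
    (hp : p.lam = p.mu) (k : ℕ) :
    p.jump (p.tail w) (k + 1) + p.lam ^ 2 * (w (k + 1) - w k) =
      p.rate (k + 1) * p.tail w (k + 1) := by
  have h1 := (omega_succ_pos (p := p) k).ne'
  have h2 := (omega_succ_pos (p := p) (k + 1)).ne'
  have h3 := tail_eq (p := p) hw0 hw1 k
  have h4 := tail_eq (p := p) hw0 hw1 (k + 1)
  -- Solved for the tail at k + 2, so that both neighbours are expressed through the tail at k + 1.
  rw [← sub_eq_iff_eq_add', eq_comm] at h4
  simp only [jump, rate, ← hp, Nat.add_sub_cancel, h3, h4]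
  field_simp
  ring

end tail

theorem exists_diagonal_bounded_potential (p : Params) (hp : p.lam = p.mu) :
    ∃ (h : ℕ → ℝ) (x : Fock →L[ℂ] Fock) (C : ℝ), (∀ k, 0 < h k) ∧
      (∀ k, x (e k) = (h k : ℂ) • e k) ∧
      ∀ k, potential p.minimalQDS x (e k) ≤ ENNReal.ofReal C := by
  have hl := p.lam_pos
  -- Increments of w, starting from 0 at index -1, are (1/2)^(k+1): positive at every site while w
  -- stays below 1. The generator therefore sends `tail w` exactly to -h.
  let w : ℕ → ℝ := fun k => 1 - (1 / 2) ^ (k + 1)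
  let h : ℕ → ℝ := fun k => p.lam ^ 2 * (1 / 2) ^ (k + 1)
  have hw0 : ∀ k, 0 < w k := fun k =>
    sub_pos.2 (pow_lt_one₀ (by norm_num) (by norm_num) (Nat.succ_ne_zero k))
  have hw1 : ∀ k, w k ≤ 1 := fun k => sub_le_self _ (by positivity)
  have hh : ∀ k, 0 < h k := fun k => by positivity
  have hgen : ∀ k, p.jump (p.tail w) k + h k = p.rate k * p.tail w k := fun k => by
    rcases k with _ | k
    · rw [← jump_tail_zero hw0 hw1]
      simp only [w, h]; ring
    · rw [← jump_tail_succ hw0 hw1 hp]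
      simp only [w, h]; ring
  obtain ⟨x, hx⟩ := exists_diagonal (f := h) (C := p.lam ^ 2) fun k => by
    rw [abs_of_pos (hh k)]
    exact mul_le_of_le_one_right (by positivity) (pow_le_one₀ (by norm_num) (by norm_num))
  exact ⟨h, x, p.tail w 0, hh, hx, fun k => (potential_e_le hx (fun k => (tail_pos hw0 hw1 k).le)
    (fun k => (hh k).le) (fun k => (hgen k).le) k).trans
    (ENNReal.ofReal_le_ofReal (tail_le hw0 hw1 k))⟩

/-- The constant weight 1 has no increments away from the boundary, so X is annihilated by the
diagonal generator at every k ≥ 1 and has defect λ² at k = 0. That defect is not strictly positive,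
which is why transience uses another weight. -/
theorem exists_superharmonic (p : Params) (hp : p.lam = p.mu) :
    ∃ X : Fock →L[ℂ] Fock,
      (∀ n : ℕ, X (e n) =
        ((∑' k : ℕ, 1 / (((n + k : ℕ) + 1 : ℝ) * ((n + k : ℕ) + p.r)) : ℝ) : ℂ) • e n) ∧
      StrictlyPositive X ∧ IsSuperharmonic p.minimalQDS X := by
  have hw0 : ∀ k : ℕ, (0 : ℝ) < (fun _ => 1) k := fun _ => one_pos
  have hw1 : ∀ k : ℕ, (fun _ => (1 : ℝ)) k ≤ 1 := fun _ => le_rfl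
  obtain ⟨X, hX⟩ := exists_diagonal (f := p.tail fun _ => 1) (C := p.tail (fun _ => 1) 0)
    fun k => by
      rw [abs_of_pos (tail_pos hw0 hw1 k)]
      exact tail_le hw0 hw1 k
  refine ⟨X, fun n => ?_, strictlyPositive_of_diagonal hX (tail_pos hw0 hw1),
    isSuperharmonic_of_diagonal hX (fun k => (tail_pos hw0 hw1 k).le) fun k => ?_⟩
  · rw [hX, tail]
    simp only [omega_succ]
  · rcases k with _ | k
    · rw [← jump_tail_zero hw0 hw1]
      exact le_add_of_nonneg_right (by positivity)
    · rw [← jump_tail_succ hw0 hw1 hp]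
      simp

end Params

end QuadOsc

end

theorem proposition3 (p : QuadOsc.Params) (h : p.lam = p.mu) :
    QuadOsc.IsTransient p.minimalQDS ∧
    (¬ ∃ ρ : QuadOsc.Fock →L[ℂ] QuadOsc.Fock,
      QuadOsc.IsDensityMatrix ρ ∧ QuadOsc.IsInvariant p.minimalQDS ρ) ∧
    ∃ X : QuadOsc.Fock →L[ℂ] QuadOsc.Fock,
      (∀ n : ℕ, X (QuadOsc.e n) =
        ((∑' k : ℕ, 1 / (((n + k : ℕ) + 1 : ℝ) * ((n + k : ℕ) + p.r)) : ℝ) : ℂ) • QuadOsc.e n) ∧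
      QuadOsc.StrictlyPositive X ∧
      QuadOsc.IsSuperharmonic p.minimalQDS X := by
  obtain ⟨d, x, C, hd, hx, hpot⟩ := QuadOsc.Params.exists_diagonal_bounded_potential p h
  exact ⟨⟨x, QuadOsc.strictlyPositive_of_diagonal hx hd,
    QuadOsc.Params.hasBoundedPotential_of_diagonal hx (fun k => (hd k).le) hpot⟩,
    QuadOsc.Params.not_exists_invariant hx hd hpot, QuadOsc.Params.exists_superharmonic p h⟩
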